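/- **Theorem 2 (Character of future singularities).** Let $I\subseteq\mathbb R$ be a nonempty open interval of proper time and let $(M,\sigma)$ be a smooth Riemannian $n$-manifold of constant curvature $k$. Consider the Friedmann universe $\mathcal V=I\times M$ with metric $ds^2=-dt^2+a^2(t)\,\sigma$, where the scale factor $a:I\to(0,\infty)$ is differentiable, and let $H=\dot a/a$ be its Hubble expansion rate. Assume that $\mathcal V$ is globally hyperbolic and regularly hyperbolic, the latter meaning here that the spatial metrics are uniformly bounded below, i.e. $a\ge c$ on $I$ for some constant $c>0$ (the lapse is $1$ and the shift is $0$). Assume that $\mathcal V$ has a future singularity, i.e. that it is future geodesically incomplete: some future-directed timelike or null geodesic, defined up to a finite value of its affine parameter, cannot be continued as a geodesic beyond this value. Then there is a finite time $t_1\in I$ such that at least one of the following conditions holds. * **S1.** For each finite $t\in I$ with $t>t_1$, $H$ is non-integrable on $[t_1,t]$. * **S2.** $H$ blows up in a finite time: there is a finite $t_s>t_1$ such that $[t_1,t_s)\subseteq I$ and $\limsup_{t\to t_s^-}|H(t)|=\infty$. * **S3.** $H$ is defined and integrable (that is, bounded, finite) for only a finite proper time interval: there is a finite $T>t_1$ such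 that $[t_1,T)\subseteq I$ and $H$ is bounded and integrable on $[t_1,T)$, whereas for no $t>T$ is $H$ both defined on all of $[t_1,t]$ and integrable there. -/

import Mathlib

open Set Filter Topology MeasureTheory
open scoped Manifold ContDiff

noncomputable section

namespace Friedmann

/-! ### Pseudo-Riemannian metrics in coordinates -/

section Coordinates

variable {W : Type*} [NormedAddCommGroup W] [NormedSpace ℝ W]

/-- The Christoffel symbol of the first kind of a metric `g` given in coordinates, as the covector
`w ↦ (1/2) (∂_u g (v, w) + ∂_v g (u, w) - ∂_w g (u, v))`. -/
def christoffelFirst (g : W → W →L[ℝ] W →L[ℝ] ℝ) (p u v : W) : W →L[ℝ] ℝ :=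
  (1 / 2 : ℝ) • (fderiv ℝ g p u v + fderiv ℝ g p v u - ((fderiv ℝ g p).flip u).flip v)

/-- The Christoffel symbol of the second kind, `Γ(u, v)`: the vector whose `g`-dual covector is
the Christoffel symbol of the first kind. -/
def christoffel (g : W → W →L[ℝ] W →L[ℝ] ℝ) (p u v : W) : W :=
  (g p).inverse (christoffelFirst g p u v)

/-- The Riemann curvature `R(u, v) w = ∇_u ∇_v w - ∇_v ∇_u w` in coordinates (for constant
coordinate fields `u`, `v`, `w`). -/
def riemannCurvature (g : W → W →L[ℝ] W →L[ℝ] ℝ) (p u v w : W) : W :=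
  fderiv ℝ (fun y => christoffel g y v w) p u - fderiv ℝ (fun y => christoffel g y u w) p v
    + christoffel g p u (christoffel g p v w) - christoffel g p v (christoffel g p u w)

end Coordinates

/-! ### The spatial slice -/

section Slice

variable {n : ℕ} {M : Type*} [TopologicalSpace M] [ChartedSpace (EuclideanSpace ℝ (Fin n)) M]
  [IsManifold (𝓡 n) ∞ M]

/-- A smooth Riemannian metric on the `n`-manifold `M`. -/
abbrev SliceMetric (n : ℕ) (M : Type*) [TopologicalSpace M]
    [ChartedSpace (EuclideanSpace ℝ (Fin n)) M] [IsManifold (𝓡 n) ∞ M] :=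
  Bundle.ContMDiffRiemannianMetric (𝓡 n) ∞ (EuclideanSpace ℝ (Fin n))
    (fun x : M => TangentSpace (𝓡 n) x)

/-- The expression of a Riemannian metric in the preferred chart at `q`, i.e. its pullback by the
inverse of this chart (meaningful on the target of the chart). -/
def chartMetric (σ : SliceMetric n M) (q : M) (y : EuclideanSpace ℝ (Fin n)) :
    EuclideanSpace ℝ (Fin n) →L[ℝ] EuclideanSpace ℝ (Fin n) →L[ℝ] ℝ :=
  let L : EuclideanSpace ℝ (Fin n) →L[ℝ] TangentSpace (𝓡 n) ((extChartAt (𝓡 n) q).symm y) :=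
    mfderiv 𝓘(ℝ, EuclideanSpace ℝ (Fin n)) (𝓡 n) (extChartAt (𝓡 n) q).symm y
  (ContinuousLinearMap.precomp ℝ L).comp ((σ.inner ((extChartAt (𝓡 n) q).symm y)).comp L)

/-- The metric `σ` has constant (sectional) curvature `k`:
`R(u, v) w = k (σ(v, w) u - σ(u, w) v)`. -/
def HasConstantCurvature (σ : SliceMetric n M) (k : ℝ) : Prop :=
  ∀ q : M, ∀ y ∈ (extChartAt (𝓡 n) q).target, ∀ u v w : EuclideanSpace ℝ (Fin n),
    riemannCurvature (chartMetric σ q) y u v w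
      = k • (chartMetric σ q y v w • u - chartMetric σ q y u w • v)

end Slice

/-! ### Friedmann universes -/

/-- A Friedmann universe: the manifold `I × M`, where `I` is a nonempty open interval of proper
time, with the metric `-dt² + a(t)² σ`, where the scale factor `a` is positive and differentiable on
`I` and `σ` is a Riemannian metric of constant curvature `k` on the `n`-manifold `M`. -/
structure Universe (n : ℕ) (M : Type*) [TopologicalSpace M]
    [ChartedSpace (EuclideanSpace ℝ (Fin n)) M] [IsManifold (𝓡 n) ∞ M] where
  /-- the interval of proper time -/
  I : Set ℝ
  isOpen_I : IsOpen I
  ordConnected_I : I.OrdConnected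
  nonempty_I : I.Nonempty
  /-- the scale factor; only its values on `I` matter -/
  a : ℝ → ℝ
  a_pos : ∀ t ∈ I, 0 < a t
  differentiableOn_a : DifferentiableOn ℝ a I
  /-- the time-independent slice metric -/
  σ : SliceMetric n M
  /-- the curvature of the slice metric -/
  k : ℝ
  constantCurvature : HasConstantCurvature σ k

namespace Universe

variable {n : ℕ} {M : Type*} [TopologicalSpace M] [ChartedSpace (EuclideanSpace ℝ (Fin n)) M]
  [IsManifold (𝓡 n) ∞ M]

/-- The spacetime `I × M`, as an open subset of `ℝ × M`. -/
def spacetime (U : Universe n M) : Set (ℝ × M) := {p | p.1 ∈ U.I}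

/-- The Hubble expansion rate `H = a' / a`. -/
def hubble (U : Universe n M) (t : ℝ) : ℝ := deriv U.a t / U.a t

/-- The Lorentzian metric `-dt² + a(t)² σ` at the point `p`, evaluated at the tangent vectors
`(r, v)` and `(r', v')`. -/
def lorentz (U : Universe n M) (p : ℝ × M) (V V' : ℝ × TangentSpace (𝓡 n) p.2) : ℝ :=
  -(V.1 * V'.1) + U.a p.1 ^ 2 * U.σ.inner p.2 V.2 V'.2

/-- The Lorentzian metric `-dt² + a(t)² σ` in the coordinates given by `t` and by the preferred
chart of `M` at `q`. -/
def coordMetric (U : Universe n M) (q : M) (p : ℝ × EuclideanSpace ℝ (Fin n)) :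
    (ℝ × EuclideanSpace ℝ (Fin n)) →L[ℝ] (ℝ × EuclideanSpace ℝ (Fin n)) →L[ℝ] ℝ :=
  -(ContinuousLinearMap.mul ℝ ℝ).bilinearComp
      (ContinuousLinearMap.fst ℝ ℝ (EuclideanSpace ℝ (Fin n)))
      (ContinuousLinearMap.fst ℝ ℝ (EuclideanSpace ℝ (Fin n)))
    + U.a p.1 ^ 2 • (chartMetric U.σ q p.2).bilinearComp
      (ContinuousLinearMap.snd ℝ ℝ (EuclideanSpace ℝ (Fin n)))
      (ContinuousLinearMap.snd ℝ ℝ (EuclideanSpace ℝ (Fin n)))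

/-- The velocity of a curve in `ℝ × M`. -/
def velocity (γ : ℝ → ℝ × M) (s : ℝ) : ℝ × TangentSpace (𝓡 n) (γ s).2 :=
  (deriv (fun u => (γ u).1) s,
    (mfderiv 𝓘(ℝ, ℝ) (𝓡 n) (fun u => (γ u).2) s : ℝ →L[ℝ] TangentSpace (𝓡 n) (γ s).2) 1)

/-- The velocity of `γ` at `s` is future-directed and timelike or null. -/
def FutureCausalAt (U : Universe n M) (γ : ℝ → ℝ × M) (s : ℝ) : Prop :=
  0 < (velocity (n := n) γ s).1 ∧ U.lorentz (γ s) (velocity γ s) (velocity γ s) ≤ 0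

/-- `q` is reached from `p` by a `C¹` future-directed causal curve segment in the spacetime. -/
def CausalSegment (U : Universe n M) (p q : ℝ × M) : Prop :=
  ∃ γ : ℝ → ℝ × M, γ 0 = p ∧ γ 1 = q ∧ ∀ s ∈ Icc (0 : ℝ) 1,
    γ s ∈ U.spacetime ∧ ContDiffAt ℝ 1 (fun u => (γ u).1) s ∧
      ContMDiffAt 𝓘(ℝ, ℝ) (𝓡 n) 1 (fun u => (γ u).2) s ∧ U.FutureCausalAt γ s

/-- The causal relation: `q` is `p`, or is reached from `p` by a piecewise `C¹` future-directed
causal curve. -/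
def CausallyPrecedes (U : Universe n M) : ℝ × M → ℝ × M → Prop :=
  Relation.ReflTransGen U.CausalSegment

/-- The causal diamond `J⁺(p) ∩ J⁻(q)`. -/
def causalDiamond (U : Universe n M) (p q : ℝ × M) : Set (ℝ × M) :=
  {z | U.CausallyPrecedes p z ∧ U.CausallyPrecedes z q}

/-- Strong causality: every neighbourhood `A` of a point contains a neighbourhood `B` such that all
(piecewise `C¹`) causal curves with endpoints in `B` stay in `A`. -/
def StronglyCausal (U : Universe n M) : Prop :=
  ∀ p ∈ U.spacetime, ∀ A ∈ 𝓝 p, ∃ B ∈ 𝓝 p, ∀ q ∈ B, ∀ r ∈ B, U.causalDiamond q r ⊆ A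

/-- Global hyperbolicity: strong causality and compactness of the causal diamonds. -/
def GloballyHyperbolic (U : Universe n M) : Prop :=
  U.StronglyCausal ∧
    ∀ p ∈ U.spacetime, ∀ q ∈ U.spacetime, IsCompact (U.causalDiamond p q)

/-- Regular hyperbolicity. The lapse is `1` and the shift is `0`, so that only the condition on the
spatial metrics `a(t)² σ` remains: they are uniformly bounded below, that is, the scale factor has
a positive lower bound. -/
def RegularlyHyperbolic (U : Universe n M) : Prop :=
  ∃ c : ℝ, 0 < c ∧ ∀ t ∈ U.I, c ≤ U.a t

/-- The curve `γ` is, on the open set `J` of parameters, a geodesic of the metric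
`-dt² + a(t)² σ`: it is twice differentiable and satisfies `γ'' + Γ(γ', γ') = 0` in coordinates. -/
def IsGeodesicOn (U : Universe n M) (γ : ℝ → ℝ × M) (J : Set ℝ) : Prop :=
  ∀ s ∈ J, γ s ∈ U.spacetime ∧ ContinuousAt γ s ∧
    let c : ℝ → ℝ × EuclideanSpace ℝ (Fin n) :=
      fun u => ((γ u).1, extChartAt (𝓡 n) (γ s).2 (γ u).2)
    (∀ᶠ u in 𝓝 s, DifferentiableAt ℝ c u) ∧
      HasDerivAt (deriv c)
        (-christoffel (U.coordMetric (γ s).2) (c s) (deriv c s) (deriv c s)) s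

/-- Future geodesic incompleteness (a future singularity): there is a future-directed timelike or
null geodesic, defined up to a finite value `β` of the affine parameter, that cannot be continued
as a geodesic beyond `β`. -/
def FutureIncomplete (U : Universe n M) : Prop :=
  ∃ (γ : ℝ → ℝ × M) (α β : ℝ), α < β ∧ U.IsGeodesicOn γ (Ioo α β) ∧
    (∀ s ∈ Ioo α β, U.FutureCausalAt γ s) ∧
    ¬ ∃ (γ' : ℝ → ℝ × M) (β' : ℝ), β < β' ∧ U.IsGeodesicOn γ' (Ioo α β') ∧
      EqOn γ' γ (Ioo α β)

end Universe

/-! ### The three kinds of behaviour of the expansion rate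

`H` is a function defined on the interval `I`, and `t₁` is a finite time in `I`. -/

/-- `H` is non-integrable on `[t₁, t]` for each finite `t` after `t₁`. -/
def S1 (I : Set ℝ) (H : ℝ → ℝ) (t₁ : ℝ) : Prop :=
  ∀ t ∈ I, t₁ < t → ¬ IntegrableOn H (Icc t₁ t)

/-- `H` blows up in a finite time: `H` is defined on some `[t₁, t_s)` with `t_s` finite, and
`limsup |H(t)| = ∞` as `t` increases to `t_s`. -/
def S2 (I : Set ℝ) (H : ℝ → ℝ) (t₁ : ℝ) : Prop :=
  ∃ ts : ℝ, t₁ < ts ∧ Ico t₁ ts ⊆ I ∧ ∀ C : ℝ, ∃ᶠ t in 𝓝[<] ts, C < |H t|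

/-- `H` is defined and integrable (and bounded) for only a finite proper time interval: it is so on
some `[t₁, T)` with `T` finite, and for `t > T` it is not defined and integrable on `[t₁, t]`. -/
def S3 (I : Set ℝ) (H : ℝ → ℝ) (t₁ : ℝ) : Prop :=
  ∃ T : ℝ, t₁ < T ∧ Ico t₁ T ⊆ I ∧ (∃ C : ℝ, ∀ t ∈ Ico t₁ T, |H t| ≤ C) ∧
    IntegrableOn H (Ico t₁ T) ∧
    ∀ t : ℝ, T < t → ¬ (Icc t₁ t ⊆ I ∧ IntegrableOn H (Icc t₁ t))

end Friedmann

end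

/-!
If the time interval `I` is bounded above, then the conclusion holds without any use of geodesics.
Near `b = sup I`, either `H` is unbounded, which is S2, or `H` is bounded on some `[t₁, b)`. In the
latter case it is integrable there, being measurable, and it is not defined after `b`; this is S3
(`Universe.exists_S2_or_S3_of_bddAbove`).

If `I` is not bounded above, then there is no future singularity (`Universe.not_futureIncomplete`),
whatever `H` does. Consider a causal geodesic `(t, x)`, defined on `(α, β)`.

* The geodesic equation splits into `t'' = -a a' σ(x', x')` and `x'' + Γ(x', x') + 2 H t' x' = 0`
  (`Universe.isGeodesicOn_iff`). The second equation does not depend on the chart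
  (`DampedGeodesicAt.change_chart`). The numbers `C = a⁴ σ(x', x')` and `e = t'² - C / a²` are
  constant and nonnegative, and `t' = √(e + C / a(t)²)` (`Universe.IsGeodesicOn.first_integrals`).
* As `a` is bounded below, `t'` and `σ(x', x')` are bounded. So `t` has a finite limit at `β`, which
  lies in `I`, and `t` extends beyond `β` as a solution of its autonomous first-order equation, by
  separation of variables (`Universe.exists_time_extension`).
* The end of the geodesic lies in a causal diamond: its spatial part, run backwards during one unit
  of time, is causal because it is short. By global hyperbolicity, `x` has a cluster point `q`
  (`Universe.exists_isCompact_of_globallyHyperbolic`). As its speed is bounded, `x` finally stays in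
  a compact ball of the chart at `q` (`exists_forall_mem_closedBall`).
* There the position `y` and the momentum `p = a² y'` satisfy `y' = a⁻² p` and
  `p' = -a⁻² Γ(p, p)`, so that `(y, p)` is an integral curve of the geodesic spray of `σ`,
  reparametrized by `τ` with `τ' = a⁻²`. It converges at `β`, is continued by an integral curve of
  the spray, and yields, with the extension of `t`, a geodesic beyond `β`.

Only the differentiability of `a` is used, which is why the equations for `t` and `x` are treated in
their first-order forms: their right-hand sides involve `a`, but not `a'`.
-/

noncomputable section

set_option linter.unusedSectionVars false
set_option maxSynthPendingDepth 3

namespace Friedmann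

/-! ### Metrics in coordinates -/

section Coordinates

variable {W : Type*} [NormedAddCommGroup W] [NormedSpace ℝ W]

lemma christoffelFirst_apply (g : W → W →L[ℝ] W →L[ℝ] ℝ) (p u v w : W) :
    christoffelFirst g p u v w
      = 1 / 2 * (fderiv ℝ g p u v w + fderiv ℝ g p v u w - fderiv ℝ g p w u v) := by
  simp [christoffelFirst]

lemma isInvertible_of_nondegenerate [FiniteDimensional ℝ W] {B : W →L[ℝ] W →L[ℝ] ℝ}
    (hB : ∀ v, B v = 0 → v = 0) : B.IsInvertible := by
  have hinj : Function.Injective (B : W →ₗ[ℝ] W →L[ℝ] ℝ) :=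
    (injective_iff_map_eq_zero _).2 hB
  have hdim : Module.finrank ℝ W = Module.finrank ℝ (W →L[ℝ] ℝ) := by
    rw [← (LinearMap.toContinuousLinearMap (𝕜 := ℝ) (E := W) (F' := ℝ)).finrank_eq]
    exact (Subspace.dual_finrank_eq (K := ℝ) (V := W)).symm
  have : FiniteDimensional ℝ (W →L[ℝ] ℝ) :=
    (LinearMap.toContinuousLinearMap (𝕜 := ℝ) (E := W) (F' := ℝ)).finiteDimensional
  exact ⟨(LinearEquiv.ofInjectiveOfFinrankEq _ hinj hdim).toContinuousLinearEquiv, by ext; rfl⟩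

lemma apply_christoffel {g : W → W →L[ℝ] W →L[ℝ] ℝ} {p : W} (hg : (g p).IsInvertible) (u v : W) :
    g p (christoffel g p u v) = christoffelFirst g p u v := by
  obtain ⟨e, he⟩ := hg
  rw [christoffel, ← he, ContinuousLinearMap.inverse_equiv]
  simp

lemma christoffel_eq_of_apply_eq {g : W → W →L[ℝ] W →L[ℝ] ℝ} {p : W} (hg : (g p).IsInvertible)
    {u v x : W} (h : ∀ w, g p x w = christoffelFirst g p u v w) : christoffel g p u v = x := by
  obtain ⟨e, he⟩ := hg
  have h' : g p x = christoffelFirst g p u v := by ext w; exact h w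
  rw [christoffel, ← h', ← he, ContinuousLinearMap.inverse_equiv]
  simp

/-- Transformation law of the Christoffel symbols under a change of coordinates `φ` which pulls
`g₂` back to `g₁`. -/
lemma fderiv_christoffel_eq {g₁ g₂ : W → W →L[ℝ] W →L[ℝ] ℝ} {φ : W → W} {y : W}
    (hφ : ContDiffAt ℝ 2 φ y)
    (hpull : ∀ᶠ z in 𝓝 y, ∀ u v, g₁ z u v = g₂ (φ z) (fderiv ℝ φ z u) (fderiv ℝ φ z v))
    (hd₁ : DifferentiableAt ℝ g₁ y) (hd₂ : DifferentiableAt ℝ g₂ (φ y))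
    (hsymm : ∀ u v, g₂ (φ y) u v = g₂ (φ y) v u)
    (h₁ : (g₁ y).IsInvertible) (h₂ : (g₂ (φ y)).IsInvertible)
    (hsurj : Function.Surjective (fderiv ℝ φ y)) (u : W) :
    fderiv ℝ φ y (christoffel g₁ y u u)
      = christoffel g₂ (φ y) (fderiv ℝ φ y u) (fderiv ℝ φ y u) + fderiv ℝ (fderiv ℝ φ) y u u := by
  have hφ1 : HasFDerivAt φ (fderiv ℝ φ y) y := (hφ.differentiableAt two_ne_zero).hasFDerivAt
  have hφ2 : HasFDerivAt (fderiv ℝ φ) (fderiv ℝ (fderiv ℝ φ) y) y :=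
    ((hφ.fderiv_right (m := 1) (by norm_num)).differentiableAt one_ne_zero).hasFDerivAt
  set D := fderiv ℝ φ y with hD
  set D2 := fderiv ℝ (fderiv ℝ φ) y with hD2
  have hd2symm : ∀ a b, D2 a b = D2 b a := fun a b =>
    (hφ.isSymmSndFDerivAt (by simp)).eq a b
  -- derivative of the pullback relation; below, all but one of the `D²φ` terms cancel
  have key : ∀ w a b, fderiv ℝ g₁ y w a b = fderiv ℝ g₂ (φ y) (D w) (D a) (D b)
      + g₂ (φ y) (D2 w a) (D b) + g₂ (φ y) (D a) (D2 w b) := by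
    intro w a b
    have e1 : HasFDerivAt (fun z => g₁ z a b) _ y :=
      (hd₁.hasFDerivAt.clm_apply (hasFDerivAt_const a y)).clm_apply (hasFDerivAt_const b y)
    have e2 : HasFDerivAt (fun z => g₂ (φ z) (fderiv ℝ φ z a) (fderiv ℝ φ z b)) _ y :=
      ((hd₂.hasFDerivAt.comp y hφ1).clm_apply
        (hφ2.clm_apply (hasFDerivAt_const a y))).clm_apply
        (hφ2.clm_apply (hasFDerivAt_const b y))
    have e3 := e1.unique (e2.congr_of_eventuallyEq (hpull.mono fun z hz => hz a b))
    have e4 := congrArg (fun L : W →L[ℝ] ℝ => L w) e3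
    simp at e4
    rw [e4]
    ring
  refine sub_eq_iff_eq_add.1 (Eq.symm ?_)
  refine christoffel_eq_of_apply_eq h₂ fun x => ?_
  obtain ⟨w, rfl⟩ := hsurj x
  have h0 : g₂ (φ y) (D (christoffel g₁ y u u)) (D w) = christoffelFirst g₁ y u u w := by
    rw [← apply_christoffel h₁, hpull.self_of_nhds]
  rw [map_sub, sub_apply, h0, christoffelFirst_apply, christoffelFirst_apply,
    key, key, hd2symm w u, hsymm (D u) (D2 u w)]
  ring

/-- Geodesics have constant speed: if `p` is parallel along the curve `y` with velocity `b p`, then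
`g(p, p)` is constant. -/
lemma hasDerivAt_norm_sq_eq_zero {g : W → W →L[ℝ] W →L[ℝ] ℝ} {y p : ℝ → W} {s b : ℝ}
    (hg : DifferentiableAt ℝ g (y s)) (hsymm : ∀ u v, g (y s) u v = g (y s) v u)
    (hinv : (g (y s)).IsInvertible) (hy : HasDerivAt y (b • p s) s)
    (hp : HasDerivAt p (-(b • christoffel g (y s) (p s) (p s))) s) :
    HasDerivAt (fun u => g (y u) (p u) (p u)) 0 s := by
  have hgy : HasDerivAt (fun u => g (y u)) (fderiv ℝ g (y s) (b • p s)) s :=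
    hg.hasFDerivAt.comp_hasDerivAt s hy
  have h := (hgy.clm_apply hp).clm_apply hp
  refine h.congr_deriv ?_
  rw [hsymm (p s)]
  simp [apply_christoffel hinv, christoffelFirst_apply]
  ring

lemma contDiffAt_christoffel [CompleteSpace W] {g : W → W →L[ℝ] W →L[ℝ] ℝ} {y p : W}
    (hg : ContDiffAt ℝ 2 g y) (hinv : (g y).IsInvertible) :
    ContDiffAt ℝ 1 (fun z : W × W => christoffel g z.1 z.2 z.2) (y, p) := by
  have h1 : ContDiffAt ℝ 1 (fun z : W × W => (g z.1).inverse) (y, p) := by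
    have : ContDiffAt ℝ 1 (fun z : W × W => g z.1) (y, p) :=
      ContDiffAt.comp (y, p) (g := g) (f := Prod.fst) (hg.of_le (by norm_num)) contDiffAt_fst
    exact ContDiffAt.comp (y, p) (g := ContinuousLinearMap.inverse) hinv.contDiffAt_map_inverse this
  have h2 : ContDiffAt ℝ 1 (fun z : W × W => fderiv ℝ g z.1) (y, p) :=
    ContDiffAt.comp (y, p) (g := fderiv ℝ g) (f := Prod.fst)
      (hg.fderiv_right (m := 1) (by norm_num)) contDiffAt_fst
  have h2' : ContDiffAt ℝ 1 (fun z : W × W => (fderiv ℝ g z.1).flip) (y, p) :=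
    (ContinuousLinearMap.flipₗᵢ ℝ W W (W →L[ℝ] ℝ)).contDiff.contDiffAt.comp (y, p) h2
  have h3 : ContDiffAt ℝ 1 (fun z : W × W => z.2) (y, p) := contDiffAt_snd
  have h4 : ContDiffAt ℝ 1 (fun z : W × W => ((fderiv ℝ g z.1).flip z.2).flip z.2) (y, p) :=
    ((ContinuousLinearMap.flipₗᵢ ℝ W W ℝ).contDiff.contDiffAt.comp (y, p)
      (h2'.clm_apply h3)).clm_apply h3
  have h5 := (h2.clm_apply h3).clm_apply h3
  exact h1.clm_apply (((h5.add h5).sub h4).const_smul (1 / 2 : ℝ))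

end Coordinates

/-! ### The slice metric in charts -/

section Slice

variable {n : ℕ} {M : Type*} [TopologicalSpace M] [ChartedSpace (EuclideanSpace ℝ (Fin n)) M]
  [IsManifold (𝓡 n) ∞ M]

local notation "𝔼" => EuclideanSpace ℝ (Fin n)

lemma chartMetric_apply (σ : SliceMetric n M) (q : M) (y u v : 𝔼) :
    chartMetric σ q y u v = σ.inner ((extChartAt (𝓡 n) q).symm y)
      (mfderiv 𝓘(ℝ, 𝔼) (𝓡 n) (extChartAt (𝓡 n) q).symm y u)
      (mfderiv 𝓘(ℝ, 𝔼) (𝓡 n) (extChartAt (𝓡 n) q).symm y v) := rfl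

lemma chartMetric_symm (σ : SliceMetric n M) (q : M) (y u v : 𝔼) :
    chartMetric σ q y u v = chartMetric σ q y v u := by
  simp only [chartMetric_apply]
  exact σ.symm _ _ _

lemma mdifferentiableAt_extChartAt_symm {q : M} {y : 𝔼} (hy : y ∈ (extChartAt (𝓡 n) q).target) :
    MDifferentiableAt 𝓘(ℝ, 𝔼) (𝓡 n) (extChartAt (𝓡 n) q).symm y :=
  ((contMDiffOn_extChartAt_symm (n := ∞) q).contMDiffAt
    ((isOpen_extChartAt_target q).mem_nhds hy)).mdifferentiableAt (by simp)

lemma injective_mfderiv_extChartAt_symm {q : M} {y : 𝔼}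
    (hy : y ∈ (extChartAt (𝓡 n) q).target) :
    Function.Injective (mfderiv 𝓘(ℝ, 𝔼) (𝓡 n) (extChartAt (𝓡 n) q).symm y) := by
  have h1 := mfderiv_extChartAt_comp_mfderivWithin_extChartAt_symm (I := 𝓡 n) (x := q) hy
  simp only [ModelWithCorners.range_eq_univ, mfderivWithin_univ] at h1
  intro u v huv
  have h2 := congrArg (fun w => mfderiv (𝓡 n) 𝓘(ℝ, 𝔼) (extChartAt (𝓡 n) q)
    ((extChartAt (𝓡 n) q).symm y) w) huv
  have h3 := fun w : 𝔼 => congrArg (fun L : 𝔼 →L[ℝ] 𝔼 => L w) h1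
  exact (h3 u).symm.trans (h2.trans (h3 v))

lemma chartMetric_pos (σ : SliceMetric n M) {q : M} {y : 𝔼}
    (hy : y ∈ (extChartAt (𝓡 n) q).target) {v : 𝔼} (hv : v ≠ 0) :
    0 < chartMetric σ q y v v := by
  rw [chartMetric_apply]
  apply σ.pos
  intro h
  exact hv (injective_mfderiv_extChartAt_symm hy (h.trans (map_zero _).symm))

lemma isInvertible_chartMetric (σ : SliceMetric n M) {q : M} {y : 𝔼}
    (hy : y ∈ (extChartAt (𝓡 n) q).target) : (chartMetric σ q y).IsInvertible := by
  refine isInvertible_of_nondegenerate fun v hv => ?_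
  by_contra hne
  have := chartMetric_pos σ hy hne
  simp [hv] at this

open scoped Bundle in
lemma contDiffOn_chartMetric (σ : SliceMetric n M) (q : M) :
    ContDiffOn ℝ ∞ (chartMetric σ q) (extChartAt (𝓡 n) q).target := by
  rw [contDiffOn_clm_apply]
  intro u
  rw [contDiffOn_clm_apply]
  intro v
  rw [← contMDiffOn_iff_contDiffOn]
  have hT : IsOpen (extChartAt (𝓡 n) q).target := isOpen_extChartAt_target q
  have hsec : ∀ w : 𝔼, ContMDiffOn 𝓘(ℝ, 𝔼) (𝓡 n).tangent ∞
      (fun y : 𝔼 => (⟨(extChartAt (𝓡 n) q).symm y,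
        mfderiv 𝓘(ℝ, 𝔼) (𝓡 n) (extChartAt (𝓡 n) q).symm y w⟩ : TangentBundle (𝓡 n) M))
      (extChartAt (𝓡 n) q).target := by
    intro w
    have h1 := (contMDiffOn_extChartAt_symm (I := 𝓡 n) (n := ∞) q).contMDiffOn_tangentMapWithin
      (m := ∞) (by simp) hT.uniqueMDiffOn
    have h2 : ContMDiffOn 𝓘(ℝ, 𝔼) 𝓘(ℝ, 𝔼).tangent ∞
        (fun y : 𝔼 => (⟨y, w⟩ : TangentBundle 𝓘(ℝ, 𝔼) 𝔼)) (extChartAt (𝓡 n) q).target := by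
      intro y hy
      exact contMDiffWithinAt_vectorSpace_iff_contDiffWithinAt (V := fun _ : 𝔼 => w).2
        contDiffWithinAt_const
    refine (h1.comp h2 fun y hy => hy).congr fun y hy => ?_
    simp only [Function.comp_apply, tangentMapWithin, mfderivWithin_of_isOpen hT hy]
  let _ : Bundle.RiemannianBundle (fun x : M => TangentSpace (𝓡 n) x) := ⟨σ.toRiemannianMetric⟩
  exact ContMDiffOn.inner_bundle (hsec u) (hsec v)

lemma contDiffAt_chartMetric (σ : SliceMetric n M) {q : M} {y : 𝔼}
    (hy : y ∈ (extChartAt (𝓡 n) q).target) : ContDiffAt ℝ ∞ (chartMetric σ q) y :=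
  (contDiffOn_chartMetric σ q).contDiffAt ((isOpen_extChartAt_target q).mem_nhds hy)

lemma differentiableAt_chartMetric (σ : SliceMetric n M) {q : M} {y : 𝔼}
    (hy : y ∈ (extChartAt (𝓡 n) q).target) : DifferentiableAt ℝ (chartMetric σ q) y :=
  (contDiffAt_chartMetric σ hy).differentiableAt (by simp)

/-- The velocity of a curve in the slice, expressed through its velocity in a chart. -/
lemma hasMFDerivAt_of_hasDerivAt_extChartAt {x : ℝ → M} {q : M} {s : ℝ} {v : 𝔼}
    (hx : ContinuousAt x s) (hq : x s ∈ (extChartAt (𝓡 n) q).source)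
    (hv : HasDerivAt (fun u => extChartAt (𝓡 n) q (x u)) v s) :
    HasMFDerivAt 𝓘(ℝ, ℝ) (𝓡 n) x s
      ((mfderiv 𝓘(ℝ, 𝔼) (𝓡 n) (extChartAt (𝓡 n) q).symm (extChartAt (𝓡 n) q (x s))).comp
        (ContinuousLinearMap.toSpanSingleton ℝ v)) := by
  have h1 := (mdifferentiableAt_extChartAt_symm
    ((extChartAt (𝓡 n) q).map_source hq)).hasMFDerivAt.comp s hv.hasFDerivAt.hasMFDerivAt
  refine h1.congr_of_eventuallyEq ?_
  filter_upwards [hx.preimage_mem_nhds ((isOpen_extChartAt_source q).mem_nhds hq)] with u hu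
  exact ((extChartAt (𝓡 n) q).left_inv hu).symm

/-- The squared speed of a curve in the slice, computed in a chart. -/
lemma inner_mfderiv_eq_chartMetric (σ : SliceMetric n M) {x : ℝ → M} {q : M} {s : ℝ} {v : 𝔼}
    (hx : ContinuousAt x s) (hq : x s ∈ (extChartAt (𝓡 n) q).source)
    (hv : HasDerivAt (fun u => extChartAt (𝓡 n) q (x u)) v s) :
    σ.inner (x s) (mfderiv 𝓘(ℝ, ℝ) (𝓡 n) x s (1 : ℝ)) (mfderiv 𝓘(ℝ, ℝ) (𝓡 n) x s (1 : ℝ))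
      = chartMetric σ q (extChartAt (𝓡 n) q (x s)) v v := by
  rw [chartMetric_apply, (hasMFDerivAt_of_hasDerivAt_extChartAt hx hq hv).mfderiv,
    (extChartAt (𝓡 n) q).left_inv hq]
  have h1 : ContinuousLinearMap.toSpanSingleton ℝ v 1 = v := by simp
  exact congrArg (fun w => σ.inner (x s)
    (mfderiv 𝓘(ℝ, 𝔼) (𝓡 n) (extChartAt (𝓡 n) q).symm (extChartAt (𝓡 n) q (x s)) w)
    (mfderiv 𝓘(ℝ, 𝔼) (𝓡 n) (extChartAt (𝓡 n) q).symm (extChartAt (𝓡 n) q (x s)) w)) h1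

/-- The change of coordinates from the preferred chart at `q₁` to the one at `q₂`. -/
def transition (q₁ q₂ : M) (y : 𝔼) : 𝔼 :=
  extChartAt (𝓡 n) q₂ ((extChartAt (𝓡 n) q₁).symm y)

lemma contDiffAt_transition {q₁ q₂ : M} {y : 𝔼} (hy : y ∈ (extChartAt (𝓡 n) q₁).target)
    (hy₂ : (extChartAt (𝓡 n) q₁).symm y ∈ (extChartAt (𝓡 n) q₂).source) :
    ContDiffAt ℝ ∞ (transition (n := n) q₁ q₂) y := by
  rw [← contMDiffAt_iff_contDiffAt]
  have h1 := (contMDiffOn_extChartAt_symm (I := 𝓡 n) (n := ∞) q₁).contMDiffAt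
    ((isOpen_extChartAt_target q₁).mem_nhds hy)
  have h2 := (contMDiffOn_extChartAt (I := 𝓡 n) (n := ∞) (x := q₂)).contMDiffAt
    ((chartAt _ q₂).open_source.mem_nhds (by rwa [extChartAt_source] at hy₂))
  exact h2.comp y h1

lemma eventually_mem_transition_domain {q₁ q₂ : M} {y : 𝔼}
    (hy : y ∈ (extChartAt (𝓡 n) q₁).target)
    (hy₂ : (extChartAt (𝓡 n) q₁).symm y ∈ (extChartAt (𝓡 n) q₂).source) :
    ∀ᶠ z in 𝓝 y, z ∈ (extChartAt (𝓡 n) q₁).target ∧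
      (extChartAt (𝓡 n) q₁).symm z ∈ (extChartAt (𝓡 n) q₂).source :=
  (show ∀ᶠ z in 𝓝 y, z ∈ (extChartAt (𝓡 n) q₁).target from
    (isOpen_extChartAt_target q₁).mem_nhds hy).and
    ((continuousAt_extChartAt_symm'' hy).preimage_mem_nhds
      ((isOpen_extChartAt_source q₂).mem_nhds hy₂))

lemma mfderiv_extChartAt_symm_eq {q₁ q₂ : M} {y : 𝔼} (hy : y ∈ (extChartAt (𝓡 n) q₁).target)
    (hy₂ : (extChartAt (𝓡 n) q₁).symm y ∈ (extChartAt (𝓡 n) q₂).source) (u : 𝔼) :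
    (mfderiv 𝓘(ℝ, 𝔼) (𝓡 n) (extChartAt (𝓡 n) q₁).symm y u : 𝔼) =
      mfderiv 𝓘(ℝ, 𝔼) (𝓡 n) (extChartAt (𝓡 n) q₂).symm (transition q₁ q₂ y)
        (fderiv ℝ (transition q₁ q₂) y u) := by
  have h1 := (mdifferentiableAt_extChartAt_symm (q := q₂) (y := transition q₁ q₂ y)
    ((extChartAt (𝓡 n) q₂).map_source hy₂)).hasMFDerivAt.comp y
    ((contDiffAt_transition hy hy₂).differentiableAt (by simp)).hasFDerivAt.hasMFDerivAt
  have h2 := h1.congr_of_eventuallyEq (f₁ := (extChartAt (𝓡 n) q₁).symm) (by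
    filter_upwards [eventually_mem_transition_domain hy hy₂] with z hz
    exact ((extChartAt (𝓡 n) q₂).left_inv hz.2).symm)
  rw [h2.mfderiv]
  rfl

lemma chartMetric_eq_transition (σ : SliceMetric n M) {q₁ q₂ : M} {y : 𝔼}
    (hy : y ∈ (extChartAt (𝓡 n) q₁).target)
    (hy₂ : (extChartAt (𝓡 n) q₁).symm y ∈ (extChartAt (𝓡 n) q₂).source) (u v : 𝔼) :
    chartMetric σ q₁ y u v = chartMetric σ q₂ (transition q₁ q₂ y)
      (fderiv ℝ (transition q₁ q₂) y u) (fderiv ℝ (transition q₁ q₂) y v) := by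
  rw [chartMetric_apply, chartMetric_apply, mfderiv_extChartAt_symm_eq hy hy₂ u,
    mfderiv_extChartAt_symm_eq hy hy₂ v]
  have : (extChartAt (𝓡 n) q₂).symm (transition q₁ q₂ y) = (extChartAt (𝓡 n) q₁).symm y :=
    (extChartAt (𝓡 n) q₂).left_inv hy₂
  rw [this]

lemma surjective_fderiv_transition {q₁ q₂ : M} {y : 𝔼}
    (hy : y ∈ (extChartAt (𝓡 n) q₁).target)
    (hy₂ : (extChartAt (𝓡 n) q₁).symm y ∈ (extChartAt (𝓡 n) q₂).source) :
    Function.Surjective (fderiv ℝ (transition (n := n) q₁ q₂) y) := by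
  refine (LinearMap.injective_iff_surjective (f := (fderiv ℝ (transition (n := n) q₁ q₂) y :
    𝔼 →ₗ[ℝ] 𝔼))).1 fun u v huv => ?_
  apply injective_mfderiv_extChartAt_symm hy
  have h := fun w => mfderiv_extChartAt_symm_eq hy hy₂ w
  refine (h u).trans (Eq.trans ?_ (h v).symm)
  exact congrArg _ huv

/-- The Christoffel symbols of the slice metric in two charts. -/
lemma fderiv_transition_christoffel (σ : SliceMetric n M) {q₁ q₂ : M} {y : 𝔼}
    (hy : y ∈ (extChartAt (𝓡 n) q₁).target)
    (hy₂ : (extChartAt (𝓡 n) q₁).symm y ∈ (extChartAt (𝓡 n) q₂).source) (u : 𝔼) :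
    fderiv ℝ (transition q₁ q₂) y (christoffel (chartMetric σ q₁) y u u)
      = christoffel (chartMetric σ q₂) (transition q₁ q₂ y) (fderiv ℝ (transition q₁ q₂) y u)
          (fderiv ℝ (transition q₁ q₂) y u) + fderiv ℝ (fderiv ℝ (transition q₁ q₂)) y u u := by
  have hφy : transition q₁ q₂ y ∈ (extChartAt (𝓡 n) q₂).target :=
    (extChartAt (𝓡 n) q₂).map_source hy₂
  refine fderiv_christoffel_eq ((contDiffAt_transition hy hy₂).of_le (by norm_cast))
    ?_ (differentiableAt_chartMetric σ hy) (differentiableAt_chartMetric σ hφy)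
    (chartMetric_symm σ q₂ _) (isInvertible_chartMetric σ hy) (isInvertible_chartMetric σ hφy)
    (surjective_fderiv_transition hy hy₂) u
  filter_upwards [eventually_mem_transition_domain hy hy₂] with z hz u v
  exact chartMetric_eq_transition σ hz.1 hz.2 u v

end Slice

/-! ### The geodesic equation -/

lemma christoffel_smul {W : Type*} [NormedAddCommGroup W] [NormedSpace ℝ W]
    (g : W → W →L[ℝ] W →L[ℝ] ℝ) (y u : W) (c : ℝ) :
    christoffel g y (c • u) (c • u) = c ^ 2 • christoffel g y u u := by
  rw [christoffel, christoffel, ← map_smul]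
  congr 1
  ext w
  simp [christoffelFirst_apply]
  ring

section Slice

variable {n : ℕ} {M : Type*} [TopologicalSpace M] [ChartedSpace (EuclideanSpace ℝ (Fin n)) M]
  [IsManifold (𝓡 n) ∞ M]

local notation "𝔼" => EuclideanSpace ℝ (Fin n)

/-- The curve `x` satisfies at the parameter `s`, in the preferred chart at `q`, the equation
`x'' + Γ(x', x') + 2 h x' = 0`. For the spatial part of a curve `(t, x)` in the spacetime, this is
the spatial part of the geodesic equation if `h = H(t) t'`. -/
def DampedGeodesicAt (σ : SliceMetric n M) (h : ℝ) (x : ℝ → M) (q : M) (s : ℝ) : Prop :=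
  x s ∈ (extChartAt (𝓡 n) q).source ∧ ContinuousAt x s ∧
    (∀ᶠ u in 𝓝 s, DifferentiableAt ℝ (fun u => extChartAt (𝓡 n) q (x u)) u) ∧
    HasDerivAt (deriv fun u => extChartAt (𝓡 n) q (x u))
      (-christoffel (chartMetric σ q) (extChartAt (𝓡 n) q (x s))
          (deriv (fun u => extChartAt (𝓡 n) q (x u)) s)
          (deriv (fun u => extChartAt (𝓡 n) q (x u)) s)
        - (2 * h) • deriv (fun u => extChartAt (𝓡 n) q (x u)) s) s

/-- The squared `σ`-length of the velocity of a curve in the slice. -/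
def speedSq (σ : SliceMetric n M) (x : ℝ → M) (s : ℝ) : ℝ :=
  σ.inner (x s) (mfderiv 𝓘(ℝ, ℝ) (𝓡 n) x s (1 : ℝ)) (mfderiv 𝓘(ℝ, ℝ) (𝓡 n) x s (1 : ℝ))

lemma speedSq_nonneg (σ : SliceMetric n M) (x : ℝ → M) (s : ℝ) : 0 ≤ speedSq σ x s := by
  by_cases h : (mfderiv 𝓘(ℝ, ℝ) (𝓡 n) x s (1 : ℝ)) = 0
  · simp [speedSq, h]
  · exact (σ.pos _ _ h).le

variable {σ : SliceMetric n M} {h : ℝ} {x : ℝ → M} {q q₁ q₂ : M} {s : ℝ}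

lemma DampedGeodesicAt.eventually_mem_source (hx : DampedGeodesicAt σ h x q s) :
    ∀ᶠ u in 𝓝 s, x u ∈ (extChartAt (𝓡 n) q).source :=
  hx.2.1.preimage_mem_nhds ((isOpen_extChartAt_source q).mem_nhds hx.1)

lemma continuousAt_of_continuousAt_extChartAt {u : ℝ}
    (hu : ∀ᶠ v in 𝓝 u, x v ∈ (extChartAt (𝓡 n) q).source)
    (hc : ContinuousAt (fun v => extChartAt (𝓡 n) q (x v)) u) : ContinuousAt x u := by
  have h1 : ContinuousAt (fun v => (extChartAt (𝓡 n) q).symm (extChartAt (𝓡 n) q (x v))) u :=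
    ContinuousAt.comp (g := (extChartAt (𝓡 n) q).symm)
      (continuousAt_extChartAt_symm'' ((extChartAt (𝓡 n) q).map_source hu.self_of_nhds)) hc
  refine h1.congr ?_
  filter_upwards [hu] with v hv
  exact (extChartAt (𝓡 n) q).left_inv hv

lemma DampedGeodesicAt.eventually_continuousAt (hx : DampedGeodesicAt σ h x q s) :
    ∀ᶠ u in 𝓝 s, ContinuousAt x u := by
  filter_upwards [hx.eventually_mem_source.eventually_nhds, hx.2.2.1] with u hu hd
  exact continuousAt_of_continuousAt_extChartAt hu hd.continuousAt

lemma speedSq_eq_chartMetric (hx : ContinuousAt x s) (hq : x s ∈ (extChartAt (𝓡 n) q).source)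
    (hd : DifferentiableAt ℝ (fun u => extChartAt (𝓡 n) q (x u)) s) :
    speedSq σ x s = chartMetric σ q (extChartAt (𝓡 n) q (x s))
      (deriv (fun u => extChartAt (𝓡 n) q (x u)) s)
      (deriv (fun u => extChartAt (𝓡 n) q (x u)) s) :=
  inner_mfderiv_eq_chartMetric σ hx hq hd.hasDerivAt

/-- The equation does not depend on the chart. -/
lemma DampedGeodesicAt.change_chart (hx : DampedGeodesicAt σ h x q₁ s)
    (h₂ : x s ∈ (extChartAt (𝓡 n) q₂).source) : DampedGeodesicAt σ h x q₂ s := by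
  obtain ⟨hs, hc, hd, hdd⟩ := id hx
  set y : ℝ → 𝔼 := fun u => extChartAt (𝓡 n) q₁ (x u) with hy
  set φ : 𝔼 → 𝔼 := transition q₁ q₂ with hφ
  have hsy : (extChartAt (𝓡 n) q₁).symm (y s) = x s := (extChartAt (𝓡 n) q₁).left_inv hs
  have hyt : y s ∈ (extChartAt (𝓡 n) q₁).target := (extChartAt (𝓡 n) q₁).map_source hs
  have hy₂ : (extChartAt (𝓡 n) q₁).symm (y s) ∈ (extChartAt (𝓡 n) q₂).source := hsy ▸ h₂
  have hφs : ContDiffAt ℝ 2 φ (y s) := (contDiffAt_transition hyt hy₂).of_le (by norm_cast)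
  have hsrc := hx.eventually_mem_source
  have heq : (fun u => extChartAt (𝓡 n) q₂ (x u)) =ᶠ[𝓝 s] fun u => φ (y u) := by
    filter_upwards [hsrc] with u hu
    simp only [hφ, hy, transition, (extChartAt (𝓡 n) q₁).left_inv hu]
  have hφd : ∀ᶠ u in 𝓝 s, DifferentiableAt ℝ φ (y u) := by
    have := hφs.eventually (by simp)
    filter_upwards [hd.self_of_nhds.continuousAt.eventually this] with u hu
    exact hu.differentiableAt two_ne_zero
  have hder : ∀ᶠ u in 𝓝 s, HasDerivAt (fun u => extChartAt (𝓡 n) q₂ (x u))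
      (fderiv ℝ φ (y u) (deriv y u)) u := by
    filter_upwards [heq.eventuallyEq_nhds, hφd, hd] with u h1 h2 h3
    exact (h2.hasFDerivAt.comp_hasDerivAt u h3.hasDerivAt).congr_of_eventuallyEq h1
  have hderiv : (deriv fun u => extChartAt (𝓡 n) q₂ (x u))
      =ᶠ[𝓝 s] fun u => fderiv ℝ φ (y u) (deriv y u) := hder.mono fun u hu => hu.deriv
  refine ⟨h₂, hc, hder.mono fun u hu => hu.differentiableAt, ?_⟩
  have hφ2 : HasDerivAt (fun u => fderiv ℝ φ (y u))
      (fderiv ℝ (fderiv ℝ φ) (y s) (deriv y s)) s :=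
    ((hφs.fderiv_right (m := 1) (by norm_num)).differentiableAt
      one_ne_zero).hasFDerivAt.comp_hasDerivAt s hd.self_of_nhds.hasDerivAt
  refine ((hφ2.clm_apply hdd).congr_of_eventuallyEq hderiv).congr_deriv ?_
  have hlaw := fderiv_transition_christoffel σ hyt hy₂ (deriv y s)
  have heqs : extChartAt (𝓡 n) q₂ (x s) = φ (y s) := heq.self_of_nhds
  rw [hderiv.self_of_nhds, heqs, map_sub, map_neg, hlaw, map_smul]
  module

/-- The first-order form of the equation, in terms of the momentum `p = A² x'`. -/
lemma DampedGeodesicAt.hasDerivAt_momentum (hx : DampedGeodesicAt σ h x q s) {A : ℝ → ℝ}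
    (hA : HasDerivAt A (h * A s) s) (hpos : A s ≠ 0) :
    HasDerivAt (fun u => A u ^ 2 • deriv (fun u => extChartAt (𝓡 n) q (x u)) u)
      (-(((A s ^ 2)⁻¹) • christoffel (chartMetric σ q) (extChartAt (𝓡 n) q (x s))
        (A s ^ 2 • deriv (fun u => extChartAt (𝓡 n) q (x u)) s)
        (A s ^ 2 • deriv (fun u => extChartAt (𝓡 n) q (x u)) s))) s := by
  refine ((hA.pow 2).smul hx.2.2.2).congr_deriv ?_
  rw [christoffel_smul, smul_smul]
  have : (A s ^ 2)⁻¹ * (A s ^ 2) ^ 2 = A s ^ 2 := by field_simp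
  rw [this]
  simp only [Pi.pow_apply, Nat.cast_ofNat]
  module

/-- Conservation of the squared `σ`-length of the momentum `A² x'`. -/
lemma DampedGeodesicAt.hasDerivAt_speedSq (hx : DampedGeodesicAt σ h x q s) {A : ℝ → ℝ}
    (hA : HasDerivAt A (h * A s) s) (hpos : A s ≠ 0) :
    HasDerivAt (fun u => A u ^ 4 * speedSq σ x u) 0 s := by
  have hp := hx.hasDerivAt_momentum hA hpos
  set y : ℝ → 𝔼 := fun u => extChartAt (𝓡 n) q (x u) with hy
  have hyt : y s ∈ (extChartAt (𝓡 n) q).target := (extChartAt (𝓡 n) q).map_source hx.1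
  have hd : HasDerivAt y ((A s ^ 2)⁻¹ • (A s ^ 2 • deriv y s)) s := by
    rw [smul_smul, inv_mul_cancel₀ (pow_ne_zero 2 hpos), one_smul]
    exact hx.2.2.1.self_of_nhds.hasDerivAt
  have h0 := hasDerivAt_norm_sq_eq_zero (g := chartMetric σ q) (y := y)
    (p := fun u => A u ^ 2 • deriv y u) (differentiableAt_chartMetric σ hyt)
    (chartMetric_symm σ q _) (isInvertible_chartMetric σ hyt) hd hp
  refine h0.congr_of_eventuallyEq ?_
  filter_upwards [hx.eventually_mem_source, hx.2.2.1, hx.eventually_continuousAt] with u h1 h2 h3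
  rw [speedSq_eq_chartMetric h3 h1 h2]
  simp only [map_smul, smul_apply, smul_eq_mul, ← hy]
  ring

end Slice

namespace Universe

variable {n : ℕ} {M : Type*} [TopologicalSpace M] [ChartedSpace (EuclideanSpace ℝ (Fin n)) M]
  [IsManifold (𝓡 n) ∞ M]

local notation "𝔼" => EuclideanSpace ℝ (Fin n)

lemma differentiableAt_a (U : Universe n M) {t : ℝ} (ht : t ∈ U.I) : DifferentiableAt ℝ U.a t :=
  (U.differentiableOn_a t ht).differentiableAt (U.isOpen_I.mem_nhds ht)

lemma coordMetric_apply (U : Universe n M) (q : M) (p V V' : ℝ × 𝔼) :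
    U.coordMetric q p V V'
      = -(V.1 * V'.1) + U.a p.1 ^ 2 * chartMetric U.σ q p.2 V.2 V'.2 := by
  simp [coordMetric]

lemma isInvertible_coordMetric (U : Universe n M) {q : M} {p : ℝ × 𝔼} (hp : p.1 ∈ U.I)
    (hy : p.2 ∈ (extChartAt (𝓡 n) q).target) : (U.coordMetric q p).IsInvertible := by
  refine isInvertible_of_nondegenerate fun V hV => ?_
  -- pairing with the time reflection of `V` turns the Lorentzian form into a definite one
  have h1 : U.coordMetric q p V (-V.1, V.2) = 0 := by rw [hV]; rfl
  rw [coordMetric_apply] at h1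
  have h2 : V.2 = 0 := by
    by_contra hne
    have := mul_pos (pow_pos (U.a_pos _ hp) 2) (chartMetric_pos U.σ hy hne)
    nlinarith [mul_self_nonneg V.1]
  have h3 : V.1 = 0 := by
    rw [h2] at h1
    simpa using h1
  exact Prod.ext h3 h2

lemma fderiv_coordMetric (U : Universe n M) {q : M} {p : ℝ × 𝔼} (hp : p.1 ∈ U.I)
    (hy : p.2 ∈ (extChartAt (𝓡 n) q).target) (X V V' : ℝ × 𝔼) :
    fderiv ℝ (U.coordMetric q) p X V V'
      = 2 * U.a p.1 * deriv U.a p.1 * X.1 * chartMetric U.σ q p.2 V.2 V'.2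
        + U.a p.1 ^ 2 * fderiv ℝ (chartMetric U.σ q) p.2 X.2 V.2 V'.2 := by
  have ha : HasFDerivAt (fun p : ℝ × 𝔼 => U.a p.1)
      (deriv U.a p.1 • ContinuousLinearMap.fst ℝ ℝ 𝔼) p :=
    (U.differentiableAt_a hp).hasDerivAt.comp_hasFDerivAt p hasFDerivAt_fst
  have hg : HasFDerivAt (fun p : ℝ × 𝔼 => chartMetric U.σ q p.2)
      ((fderiv ℝ (chartMetric U.σ q) p.2).comp (ContinuousLinearMap.snd ℝ ℝ 𝔼)) p :=
    (differentiableAt_chartMetric U.σ hy).hasFDerivAt.comp p hasFDerivAt_snd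
  have hd : DifferentiableAt ℝ (U.coordMetric q) p := by
    have h1 : (U.coordMetric q) = fun p : ℝ × 𝔼 => -(ContinuousLinearMap.mul ℝ ℝ).bilinearComp
      (ContinuousLinearMap.fst ℝ ℝ 𝔼) (ContinuousLinearMap.fst ℝ ℝ 𝔼)
      + U.a p.1 ^ 2 • ((ContinuousLinearMap.precomp ℝ (ContinuousLinearMap.snd ℝ ℝ 𝔼)).comp
        ((chartMetric U.σ q p.2).comp (ContinuousLinearMap.snd ℝ ℝ 𝔼))) := rfl
    rw [h1]
    refine (differentiableAt_const _).add ((ha.differentiableAt.pow 2).smul ?_)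
    exact (differentiableAt_const _).clm_comp
      (hg.differentiableAt.clm_comp (differentiableAt_const _))
  have e1 := (hd.hasFDerivAt.clm_apply (hasFDerivAt_const V p)).clm_apply (hasFDerivAt_const V' p)
  have e2 := ((ha.pow 2).mul ((hg.clm_apply (hasFDerivAt_const V.2 p)).clm_apply
    (hasFDerivAt_const V'.2 p))).const_add (-(V.1 * V'.1))
  have e3 := e1.unique (e2.congr_of_eventuallyEq
    (Eventually.of_forall fun z => coordMetric_apply U q z V V'))
  have e4 := congrArg (fun L : ℝ × 𝔼 →L[ℝ] ℝ => L X) e3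
  simp at e4
  rw [e4]
  ring

/-- The Christoffel symbols of `-dt² + a² σ` are `Γᵗ(V, V) = a a' σ(v, v)` and
`Γˣ(V, V) = Γ(v, v) + 2 H r v` for `V = (r, v)`. -/
lemma christoffel_coordMetric (U : Universe n M) {q : M} {p : ℝ × 𝔼} (hp : p.1 ∈ U.I)
    (hy : p.2 ∈ (extChartAt (𝓡 n) q).target) (V : ℝ × 𝔼) :
    christoffel (U.coordMetric q) p V V
      = (U.a p.1 * deriv U.a p.1 * chartMetric U.σ q p.2 V.2 V.2,
        christoffel (chartMetric U.σ q) p.2 V.2 V.2 + (2 * (U.hubble p.1 * V.1)) • V.2) := by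
  refine christoffel_eq_of_apply_eq (U.isInvertible_coordMetric hp hy) fun X => ?_
  rw [coordMetric_apply, christoffelFirst_apply, fderiv_coordMetric U hp hy,
    fderiv_coordMetric U hp hy]
  simp only [map_add, map_smul, add_apply, smul_apply,
    smul_eq_mul]
  rw [apply_christoffel (isInvertible_chartMetric U.σ hy), christoffelFirst_apply]
  have := (U.a_pos _ hp).ne'
  simp only [hubble]
  field_simp
  ring

/-- The geodesic equation, split into its time component and its spatial component. -/
lemma isGeodesicOn_iff (U : Universe n M) (γ : ℝ → ℝ × M) (J : Set ℝ) :
    U.IsGeodesicOn γ J ↔ ∀ s ∈ J, (γ s).1 ∈ U.I ∧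
      (∀ᶠ u in 𝓝 s, DifferentiableAt ℝ (fun u => (γ u).1) u) ∧
      HasDerivAt (deriv fun u => (γ u).1)
        (-(U.a (γ s).1 * deriv U.a (γ s).1 * speedSq U.σ (fun u => (γ u).2) s)) s ∧
      ∃ q, DampedGeodesicAt U.σ (U.hubble (γ s).1 * deriv (fun u => (γ u).1) s)
        (fun u => (γ u).2) q s := by
  refine forall₂_congr fun s _ => ?_
  set t : ℝ → ℝ := fun u => (γ u).1 with ht
  set x : ℝ → M := fun u => (γ u).2 with hx
  set y : ℝ → 𝔼 := fun u => extChartAt (𝓡 n) (x s) (x u) with hy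
  have hsrc : x s ∈ (extChartAt (𝓡 n) (x s)).source := mem_extChartAt_source _
  have htar : y s ∈ (extChartAt (𝓡 n) (x s)).target := (extChartAt (𝓡 n) (x s)).map_source hsrc
  have hdc : ∀ u, DifferentiableAt ℝ t u → DifferentiableAt ℝ y u →
      HasDerivAt (fun u => (t u, y u)) (deriv t u, deriv y u) u :=
    fun u h1 h2 => h1.hasDerivAt.prodMk h2.hasDerivAt
  constructor
  · rintro ⟨hI, hc, hd, hdd⟩
    change ∀ᶠ u in 𝓝 s, DifferentiableAt ℝ (fun u => (t u, y u)) u at hd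
    change HasDerivAt (deriv fun u => (t u, y u)) (-christoffel (U.coordMetric (x s)) (t s, y s)
      (deriv (fun u => (t u, y u)) s) (deriv (fun u => (t u, y u)) s)) s at hdd
    have hdt : ∀ᶠ u in 𝓝 s, DifferentiableAt ℝ t u := hd.mono fun u hu => hu.fst
    have hdy : ∀ᶠ u in 𝓝 s, DifferentiableAt ℝ y u := hd.mono fun u hu => hu.snd
    have heq : deriv (fun u => (t u, y u)) =ᶠ[𝓝 s] fun u => (deriv t u, deriv y u) := by
      filter_upwards [hdt, hdy] with u h1 h2
      exact (hdc u h1 h2).deriv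
    rw [heq.self_of_nhds, U.christoffel_coordMetric (q := x s) (p := (t s, y s)) hI htar] at hdd
    have hdd' := hdd.congr_of_eventuallyEq heq.symm
    have hxc : ContinuousAt x s := continuousAt_snd.comp hc
    refine ⟨hI, hdt, ?_, x s, hsrc, hxc, hdy, ?_⟩
    · rw [speedSq_eq_chartMetric hxc hsrc hdy.self_of_nhds]
      exact hdd'.fst
    · have h2 : HasDerivAt (deriv y) (-(christoffel (chartMetric U.σ (x s)) (y s)
          (deriv y s) (deriv y s) + (2 * (U.hubble (t s) * deriv t s)) • deriv y s)) s := hdd'.snd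
      exact h2.congr_deriv (by rw [neg_add, sub_eq_add_neg])
  · rintro ⟨hI, hdt, hddt, q, hq⟩
    obtain ⟨-, hxc, hdy, hddy⟩ := hq.change_chart hsrc
    change ∀ᶠ u in 𝓝 s, DifferentiableAt ℝ y u at hdy
    have heq : deriv (fun u => (t u, y u)) =ᶠ[𝓝 s] fun u => (deriv t u, deriv y u) := by
      filter_upwards [hdt, hdy] with u h1 h2
      exact (hdc u h1 h2).deriv
    refine ⟨hI, hdt.self_of_nhds.continuousAt.prodMk hxc, ?_, ?_⟩
    · filter_upwards [hdt, hdy] with u h1 h2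
      exact (hdc u h1 h2).differentiableAt
    · change HasDerivAt (deriv fun u => (t u, y u)) (-christoffel (U.coordMetric (x s)) (t s, y s)
        (deriv (fun u => (t u, y u)) s) (deriv (fun u => (t u, y u)) s)) s
      rw [heq.self_of_nhds, U.christoffel_coordMetric (q := x s) (p := (t s, y s)) hI htar]
      refine HasDerivAt.congr_of_eventuallyEq ?_ heq
      rw [speedSq_eq_chartMetric hxc hsrc hdy.self_of_nhds] at hddt
      refine (hddt.prodMk hddy).congr_deriv ?_
      refine Prod.ext rfl ?_
      simp only [Prod.snd_neg]
      rw [neg_add, sub_eq_add_neg]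

end Universe

/-! ### Ordinary differential equations on the line, and the end of time -/

section RealAnalysis

variable {F : Type*} [NormedAddCommGroup F] [NormedSpace ℝ F]

lemma exists_tendsto_of_norm_deriv_le [CompleteSpace F] {f f' : ℝ → F} {a b C : ℝ} (hab : a < b)
    (hf : ∀ s ∈ Ioo a b, HasDerivAt f (f' s) s) (hC : ∀ s ∈ Ioo a b, ‖f' s‖ ≤ C) :
    ∃ l, Tendsto f (𝓝[<] b) (𝓝 l) := by
  have hlip : LipschitzOnWith C.toNNReal f (Ioo a b) :=
    (convex_Ioo a b).lipschitzOnWith_of_nnnorm_hasDerivWithin_le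
      (fun s hs => (hf s hs).hasDerivWithinAt) fun s hs =>
        NNReal.coe_le_coe.1 ((hC s hs).trans (Real.le_coe_toNNReal C))
  have hne : (𝓝[<] b).NeBot := inferInstance
  have hc : Cauchy (map f (𝓝[<] b)) :=
    Cauchy.map_of_le (cauchy_nhds.mono nhdsWithin_le_nhds) hlip.uniformContinuousOn
      (le_principal_iff.2 (Ioo_mem_nhdsLT hab))
  exact CompleteSpace.complete hc

/-- Two solutions of `z' = V(s, z)`, one ending and one starting at the same point, join to a
solution. -/
lemma hasDerivAt_glue {V : ℝ → F → F} {f g : ℝ → F} {a b c : ℝ} (hab : a < b) (hbc : b < c)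
    (hV : ContinuousAt (Function.uncurry V) (b, g b))
    (hf : ∀ s ∈ Ioo a b, HasDerivAt f (V s (f s)) s) (hl : Tendsto f (𝓝[<] b) (𝓝 (g b)))
    (hg : ∀ s ∈ Ico b c, HasDerivAt g (V s (g s)) s) :
    ∀ s ∈ Ioo a c, HasDerivAt (fun u => if u < b then f u else g u)
      (V s (if s < b then f s else g s)) s := by
  set Z : ℝ → F := fun u => if u < b then f u else g u with hZ
  have hl1 : ∀ s < b, Z =ᶠ[𝓝 s] f := fun s hs => by
    filter_upwards [Iio_mem_nhds hs] with u hu using if_pos hu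
  have hr1 : ∀ s, b < s → Z =ᶠ[𝓝 s] g := fun s hs => by
    filter_upwards [Ioi_mem_nhds hs] with u hu using if_neg (not_lt.2 hu.le)
  have hZb : Z b = g b := if_neg (lt_irrefl b)
  intro s hs
  change HasDerivAt Z (V s (Z s)) s
  rcases lt_trichotomy s b with h | rfl | h
  · rw [(hl1 s h).self_of_nhds]
    exact (hf s ⟨hs.1, h⟩).congr_of_eventuallyEq (hl1 s h)
  · have hB : HasDerivWithinAt Z (V s (Z s)) (Ici s) s := by
      rw [hZb]
      refine ((hg s ⟨le_rfl, hbc⟩).hasDerivWithinAt (s := Ici s)).congr (fun u hu => ?_) hZb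
      exact if_neg (not_lt.2 hu)
    have hA : HasDerivWithinAt Z (V s (Z s)) (Iic s) s := by
      have hlZ : Tendsto Z (𝓝[<] s) (𝓝 (Z s)) := by
        rw [hZb]
        refine hl.congr' ?_
        filter_upwards [self_mem_nhdsWithin] with u hu using (if_pos hu).symm
      refine hasDerivWithinAt_Iic_of_tendsto_deriv (s := Ioo a s)
        (fun u hu => ((hf u hu).congr_of_eventuallyEq
          (hl1 u hu.2)).differentiableAt.differentiableWithinAt)
        (hlZ.mono_left (nhdsWithin_mono _ fun u hu => hu.2)) (Ioo_mem_nhdsLT hab) ?_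
      have h1 : Tendsto (fun u => (u, Z u)) (𝓝[<] s) (𝓝 (s, g s)) :=
        (tendsto_nhdsWithin_of_tendsto_nhds tendsto_id).prodMk_nhds (hZb ▸ hlZ)
      have h2 := hV.tendsto.comp h1
      rw [hZb]
      refine h2.congr' ?_
      filter_upwards [Ioo_mem_nhdsLT hab] with u hu
      rw [((hf u hu).congr_of_eventuallyEq (hl1 u hu.2)).deriv]
      simp only [Function.comp_apply, Function.uncurry_apply_pair, hZ, if_pos hu.2]
    simpa using hA.union hB
  · rw [(hr1 s h).self_of_nhds]
    exact (hg s ⟨h.le, hs.2⟩).congr_of_eventuallyEq (hr1 s h)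

/-- An autonomous scalar equation with positive, merely continuous right-hand side can be solved by
separation of variables. -/
lemma exists_solution_of_continuousOn_of_pos {f : ℝ → ℝ} {S : Set ℝ} (hS : IsOpen S)
    (hf : ContinuousOn f S) (hpos : ∀ t ∈ S, 0 < f t) {t₀ : ℝ} (h₀ : t₀ ∈ S) :
    ∃ ψ : ℝ → ℝ, ψ 0 = t₀ ∧ ∀ᶠ u in 𝓝 0, ψ u ∈ S ∧ HasDerivAt ψ (f (ψ u)) u := by
  obtain ⟨ρ, hρ, hball⟩ := Metric.isOpen_iff.1 hS t₀ h₀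
  have hfi : ContinuousOn (fun t => (f t)⁻¹) S := hf.inv₀ fun t ht => (hpos t ht).ne'
  -- `Θ` is the parameter as a function of time; the solution is its local inverse
  set Θ : ℝ → ℝ := fun t => ∫ r in t₀..t, (f r)⁻¹ with hΘ
  have hΘ' : ∀ t ∈ Metric.ball t₀ ρ, HasStrictDerivAt Θ (f t)⁻¹ t := by
    intro t ht
    refine intervalIntegral.integral_hasStrictDerivAt_right ?_
      (hfi.stronglyMeasurableAtFilter hS t (hball ht))
      (hfi.continuousAt (hS.mem_nhds (hball ht)))
    refine (hfi.mono ?_).intervalIntegrable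
    exact (((convex_ball t₀ ρ).ordConnected.uIcc_subset
      (Metric.mem_ball_self hρ) ht)).trans hball
  have hstrict := hΘ' t₀ (Metric.mem_ball_self hρ)
  have hne : (f t₀)⁻¹ ≠ 0 := (inv_pos.2 (hpos t₀ h₀)).ne'
  set e := (hstrict.hasStrictFDerivAt_equiv hne).toOpenPartialHomeomorph Θ with he
  have hee : ∀ t, e t = Θ t := fun t => rfl
  have hmem : t₀ ∈ e.source :=
    (hstrict.hasStrictFDerivAt_equiv hne).mem_toOpenPartialHomeomorph_source
  have hΘ0 : e t₀ = 0 := by simp [hee, hΘ]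
  have h0 : (0 : ℝ) ∈ e.target := hΘ0 ▸ e.map_source hmem
  have hψ0 : e.symm 0 = t₀ := by rw [← hΘ0, e.left_inv hmem]
  refine ⟨e.symm, hψ0, ?_⟩
  have hcont : ContinuousAt e.symm 0 := e.continuousAt_symm h0
  have hmem' : ∀ᶠ u in 𝓝 (0 : ℝ), e.symm u ∈ Metric.ball t₀ ρ :=
    hcont.preimage_mem_nhds (by rw [hψ0]; exact Metric.ball_mem_nhds t₀ hρ)
  filter_upwards [hmem', e.open_target.mem_nhds h0] with u hu hut
  refine ⟨hball hu, ?_⟩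
  have h1 := e.hasDerivAt_symm hut (inv_pos.2 (hpos _ (hball hu))).ne' (hΘ' _ hu).hasDerivAt
  simpa using h1

end RealAnalysis

namespace Universe

variable {n : ℕ} {M : Type*} [TopologicalSpace M] [ChartedSpace (EuclideanSpace ℝ (Fin n)) M]
  [IsManifold (𝓡 n) ∞ M]

/-- If time ends, then the expansion rate is unbounded near the end, or it is bounded there and not
defined afterwards. -/
lemma exists_S2_or_S3_of_bddAbove (U : Universe n M) (hb : BddAbove U.I) :
    ∃ t₁ ∈ U.I, S2 U.I U.hubble t₁ ∨ S3 U.I U.hubble t₁ := by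
  obtain ⟨t₀, ht₀⟩ := U.nonempty_I
  set b := sSup U.I with hbdef
  have hlub : IsLUB U.I b := isLUB_csSup U.nonempty_I hb
  have hlt : ∀ t ∈ U.I, t < b := fun t ht =>
    (hlub.1 ht).lt_of_ne fun h => by
      obtain ⟨u, hu, hu'⟩ := (mem_nhdsGT_iff_exists_Ioc_subset (a := t)).1
        (mem_nhdsWithin_of_mem_nhds (U.isOpen_I.mem_nhds ht))
      exact absurd (hlub.1 (hu' ⟨hu, le_rfl⟩)) (not_le.2 (h ▸ hu))
  have hsub : ∀ t ∈ U.I, Ico t b ⊆ U.I := fun t ht u hu => by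
    obtain ⟨v, hv, huv, -⟩ := hlub.exists_between hu.2
    exact U.ordConnected_I.out ht hv ⟨hu.1, huv.le⟩
  by_cases h : ∀ C : ℝ, ∃ᶠ t in 𝓝[<] b, C < |U.hubble t|
  · exact ⟨t₀, ht₀, Or.inl ⟨b, hlt t₀ ht₀, hsub t₀ ht₀, h⟩⟩
  · push Not at h
    obtain ⟨C, hC⟩ := h
    obtain ⟨l, hl, hlC⟩ := mem_nhdsLT_iff_exists_Ico_subset.1 hC
    set t₁ := max l t₀ with ht₁
    have ht₁b : t₁ < b := max_lt hl (hlt t₀ ht₀)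
    have ht₁I : t₁ ∈ U.I := hsub t₀ ht₀ ⟨le_max_right _ _, ht₁b⟩
    have hbound : ∀ t ∈ Ico t₁ b, |U.hubble t| ≤ C := fun t ht =>
      hlC ⟨(le_max_left _ _).trans ht.1, ht.2⟩
    refine ⟨t₁, ht₁I, Or.inr ⟨b, ht₁b, hsub t₁ ht₁I, ⟨C, hbound⟩, ?_, ?_⟩⟩
    · have hmeas : AEMeasurable U.hubble (volume.restrict (Ico t₁ b)) :=
        (measurable_deriv U.a).aemeasurable.div
          ((U.differentiableOn_a.continuousOn.mono (hsub t₁ ht₁I)).aemeasurable measurableSet_Ico)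
      refine IntegrableOn.of_bound (by simp) hmeas.aestronglyMeasurable C ?_
      filter_upwards [ae_restrict_mem measurableSet_Ico] with t ht using hbound t ht
    · rintro t ht ⟨hsubt, -⟩
      exact absurd (hlt b (hsubt ⟨ht₁b.le, ht.le⟩)) (lt_irrefl b)

end Universe

/-! ### First integrals and causal curves -/

lemma contDiffAt_one_of_eventually {F : Type*} [NormedAddCommGroup F] [NormedSpace ℝ F]
    {f : ℝ → F} {s : ℝ}
    (h : ∀ᶠ u in 𝓝 s, DifferentiableAt ℝ f u ∧ DifferentiableAt ℝ (deriv f) u) :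
    ContDiffAt ℝ 1 f s := by
  obtain ⟨S, hS, hSo, hs⟩ := eventually_nhds_iff.1 h
  refine ContDiffOn.contDiffAt (s := S) ?_ (hSo.mem_nhds hs)
  have h1 : ((1 : WithTop ℕ∞)) = 0 + 1 := by norm_num
  rw [h1, contDiffOn_succ_iff_deriv_of_isOpen hSo]
  refine ⟨fun u hu => (hS u hu).1.differentiableWithinAt, by simp, ?_⟩
  exact contDiffOn_zero.2 fun u hu => (hS u hu).2.continuousAt.continuousWithinAt

section Slice

variable {n : ℕ} {M : Type*} [TopologicalSpace M] [ChartedSpace (EuclideanSpace ℝ (Fin n)) M]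
  [IsManifold (𝓡 n) ∞ M]

local notation "𝔼" => EuclideanSpace ℝ (Fin n)

variable {σ : SliceMetric n M} {x : ℝ → M} {s : ℝ}

lemma contMDiffAt_of_dampedGeodesicAt {h : ℝ → ℝ}
    (hx : ∀ᶠ u in 𝓝 s, ∃ q, DampedGeodesicAt σ (h u) x q u) :
    ContMDiffAt 𝓘(ℝ, ℝ) (𝓡 n) 1 x s := by
  obtain ⟨q, hq⟩ := hx.self_of_nhds
  have hev : ∀ᶠ u in 𝓝 s, DampedGeodesicAt σ (h u) x q u := by
    filter_upwards [hx, hq.eventually_mem_source] with u ⟨q', hq'⟩ hu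
    exact hq'.change_chart hu
  have hy : ContDiffAt ℝ 1 (fun u => extChartAt (𝓡 n) q (x u)) s :=
    contDiffAt_one_of_eventually
      (hev.mono fun u hu => ⟨hu.2.2.1.self_of_nhds, hu.2.2.2.differentiableAt⟩)
  have htar := (extChartAt (𝓡 n) q).map_source hq.1
  have hsymm := ((contMDiffOn_extChartAt_symm (I := 𝓡 n) (n := ∞) q).contMDiffAt
    ((isOpen_extChartAt_target q).mem_nhds htar)).of_le (m := 1) (by norm_cast)
  refine (hsymm.comp s hy.contMDiffAt).congr_of_eventuallyEq ?_
  filter_upwards [hq.eventually_mem_source] with u hu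
  exact ((extChartAt (𝓡 n) q).left_inv hu).symm

lemma speedSq_comp_affine {m k u : ℝ} (hx : MDifferentiableAt 𝓘(ℝ, ℝ) (𝓡 n) x (m + u * k)) :
    speedSq σ (fun u => x (m + u * k)) u = k ^ 2 * speedSq σ x (m + u * k) := by
  have hℓ : HasDerivAt (fun u : ℝ => m + u * k) k u := by
    simpa using ((hasDerivAt_id u).mul_const k).const_add m
  have h1 := hx.hasMFDerivAt.comp u hℓ.hasFDerivAt.hasMFDerivAt
  have h2 : (mfderiv 𝓘(ℝ, ℝ) (𝓡 n) (fun u => x (m + u * k)) u (1 : ℝ) : 𝔼)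
      = k • (mfderiv 𝓘(ℝ, ℝ) (𝓡 n) x (m + u * k) (1 : ℝ) : 𝔼) := by
    have h3 : mfderiv 𝓘(ℝ, ℝ) (𝓡 n) (fun u => x (m + u * k)) u = _ := h1.mfderiv
    rw [h3]
    have h4 : ContinuousLinearMap.toSpanSingleton ℝ k (1 : ℝ) = k • (1 : ℝ) := by simp
    exact (congrArg (fun r : ℝ => (mfderiv 𝓘(ℝ, ℝ) (𝓡 n) x (m + u * k) r : 𝔼)) h4).trans
      (ContinuousLinearMap.map_smul (mfderiv 𝓘(ℝ, ℝ) (𝓡 n) x (m + u * k) : ℝ →L[ℝ] 𝔼) k (1 : ℝ))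
  let B : 𝔼 →L[ℝ] 𝔼 →L[ℝ] ℝ := σ.inner (x (m + u * k))
  have h5 : ∀ v : 𝔼, B (k • v) (k • v) = k ^ 2 * B v v := fun v => by
    simp only [map_smul, smul_apply, smul_eq_mul]
    ring
  exact (congrArg (fun v : 𝔼 => B v v) h2).trans (h5 _)

end Slice

namespace Universe

variable {n : ℕ} {M : Type*} [TopologicalSpace M] [ChartedSpace (EuclideanSpace ℝ (Fin n)) M]
  [IsManifold (𝓡 n) ∞ M] {U : Universe n M} {γ : ℝ → ℝ × M} {α β : ℝ}

lemma lorentz_velocity (U : Universe n M) (γ : ℝ → ℝ × M) (s : ℝ) :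
    U.lorentz (γ s) (velocity γ s) (velocity γ s)
      = -(deriv (fun u => (γ u).1) s) ^ 2 + U.a (γ s).1 ^ 2 * speedSq U.σ (fun u => (γ u).2) s := by
  rw [pow_two (deriv (fun u => (γ u).1) s)]
  rfl

lemma deriv_a_eq (U : Universe n M) {t : ℝ} (ht : t ∈ U.I) :
    deriv U.a t = U.hubble t * U.a t := by
  have := (U.a_pos t ht).ne'
  simp only [hubble]
  field_simp

/-- The first integrals of a causal geodesic: the squared `σ`-length `C` of the momentum `a² x'`,
and `e = t'² - a² σ(x', x')`. They determine `t'` as a positive function of `t` alone. -/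
lemma IsGeodesicOn.first_integrals (hγ : U.IsGeodesicOn γ (Ioo α β)) (hαβ : α < β)
    (hc : ∀ s ∈ Ioo α β, U.FutureCausalAt γ s) :
    ∃ C e : ℝ, 0 ≤ C ∧ 0 ≤ e ∧ (∀ r : ℝ, 0 < r → 0 < e + C / r ^ 2) ∧ ∀ s ∈ Ioo α β,
      U.a (γ s).1 ^ 4 * speedSq U.σ (fun u => (γ u).2) s = C ∧
        HasDerivAt (fun u => (γ u).1) √(e + C / U.a (γ s).1 ^ 2) s := by
  rw [isGeodesicOn_iff] at hγ
  set t : ℝ → ℝ := fun u => (γ u).1 with ht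
  set x : ℝ → M := fun u => (γ u).2 with hx
  have hdt : ∀ s ∈ Ioo α β, HasDerivAt t (deriv t s) s := fun s hs =>
    (hγ s hs).2.1.self_of_nhds.hasDerivAt
  have hapos : ∀ s ∈ Ioo α β, 0 < U.a (t s) := fun s hs => U.a_pos _ (hγ s hs).1
  have hA : ∀ s ∈ Ioo α β, HasDerivAt (fun u => U.a (t u)) (deriv U.a (t s) * deriv t s) s :=
    fun s hs => (U.differentiableAt_a (hγ s hs).1).hasDerivAt.comp s (hdt s hs)
  have hC0 : ∀ s ∈ Ioo α β, HasDerivAt (fun u => U.a (t u) ^ 4 * speedSq U.σ x u) 0 s := by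
    intro s hs
    obtain ⟨hI, -, -, q, hq⟩ := hγ s hs
    refine hq.hasDerivAt_speedSq (A := fun u => U.a (t u)) ?_ (hapos s hs).ne'
    refine (hA s hs).congr_deriv ?_
    rw [U.deriv_a_eq hI]
    ring
  obtain ⟨C, hC⟩ := isOpen_Ioo.exists_is_const_of_deriv_eq_zero isPreconnected_Ioo
    (fun s hs => (hC0 s hs).differentiableAt.differentiableWithinAt) fun s hs => (hC0 s hs).deriv
  have hQ : ∀ s ∈ Ioo α β, speedSq U.σ x s = C / U.a (t s) ^ 4 := fun s hs => by
    rw [← hC s hs, mul_div_cancel_left₀ _ (pow_pos (hapos s hs) 4).ne']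
  have he0 : ∀ s ∈ Ioo α β, HasDerivAt (fun u => deriv t u ^ 2 - C / U.a (t u) ^ 2) 0 s := by
    intro s hs
    have h1 := ((hγ s hs).2.2.1.pow 2).sub
      (((hA s hs).pow 2).inv (pow_pos (hapos s hs) 2).ne' |>.const_mul C)
    have h2 : (fun u => deriv t u ^ 2 - C / U.a (t u) ^ 2)
        = (deriv t ^ 2 - fun u => C * (((fun u => U.a (t u)) ^ 2)⁻¹ : ℝ → ℝ) u) := by
      funext u
      simp [div_eq_mul_inv]
    rw [h2]
    refine h1.congr_deriv ?_
    have := (hapos s hs).ne'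
    rw [hQ s hs]
    simp
    field_simp
    ring
  obtain ⟨e, he⟩ := isOpen_Ioo.exists_is_const_of_deriv_eq_zero isPreconnected_Ioo
    (fun s hs => (he0 s hs).differentiableAt.differentiableWithinAt) fun s hs => (he0 s hs).deriv
  have htpos : ∀ s ∈ Ioo α β, 0 < deriv t s := fun s hs => (hc s hs).1
  have hmid : (α + β) / 2 ∈ Ioo α β := ⟨by linarith, by linarith⟩
  have hCnn : 0 ≤ C := by
    rw [← hC _ hmid]
    exact mul_nonneg (pow_pos (hapos _ hmid) 4).le (speedSq_nonneg _ _ _)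
  have henn : 0 ≤ e := by
    have h1 := (hc _ hmid).2
    rw [lorentz_velocity] at h1
    change -(deriv t _) ^ 2 + U.a (t _) ^ 2 * speedSq U.σ x _ ≤ 0 at h1
    rw [hQ _ hmid] at h1
    have h2 : U.a (t ((α + β) / 2)) ^ 2 * (C / U.a (t ((α + β) / 2)) ^ 4)
        = C / U.a (t ((α + β) / 2)) ^ 2 := by
      have := (hapos _ hmid).ne'
      field_simp
    rw [← he _ hmid]
    linarith
  refine ⟨C, e, hCnn, henn, fun r hr => ?_, fun s hs => ⟨hC s hs, ?_⟩⟩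
  · rcases henn.lt_or_eq with h | h
    · positivity
    · rcases hCnn.lt_or_eq with h' | h'
      · positivity
      · have h1 := he _ hmid
        rw [← h, ← h'] at h1
        have h2 := pow_pos (htpos _ hmid) 2
        simp only [zero_div, sub_zero] at h1
        exact absurd h1 h2.ne'
  · have h1 : e + C / U.a (t s) ^ 2 = deriv t s ^ 2 := by
      rw [← he s hs]
      ring
    change HasDerivAt t √(e + C / U.a (t s) ^ 2) s
    rw [h1, Real.sqrt_sq (htpos s hs).le]
    exact hdt s hs

lemma mem_I_of_le (hI : ¬ BddAbove U.I) {t t' : ℝ} (ht : t ∈ U.I) (h : t ≤ t') : t' ∈ U.I := by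
  obtain ⟨u, hu, hu'⟩ := not_bddAbove_iff.1 hI t'
  exact U.ordConnected_I.out ht hu ⟨h, hu'.le⟩

/-- If time does not end, then a solution of `t' = f(t)` with `f` positive, continuous and bounded
can be continued beyond each finite parameter value. -/
lemma exists_time_extension (hI : ¬ BddAbove U.I) {f t : ℝ → ℝ} (hαβ : α < β)
    (hf : ContinuousOn f U.I) (hpos : ∀ r ∈ U.I, 0 < f r) {B : ℝ} (hB : ∀ r ∈ U.I, f r ≤ B)
    (htI : ∀ s ∈ Ioo α β, t s ∈ U.I) (ht : ∀ s ∈ Ioo α β, HasDerivAt t (f (t s)) s) :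
    ∃ δ > 0, ∃ T : ℝ → ℝ, EqOn T t (Ioo α β) ∧
      ∀ s ∈ Ioo α (β + δ), T s ∈ U.I ∧ HasDerivAt T (f (T s)) s := by
  obtain ⟨l, hl⟩ := exists_tendsto_of_norm_deriv_le hαβ ht (C := B) fun s hs => by
    rw [Real.norm_of_nonneg (hpos _ (htI s hs)).le]
    exact hB _ (htI s hs)
  have hmono : StrictMonoOn t (Ioo α β) := strictMonoOn_of_deriv_pos (convex_Ioo α β)
    (fun s hs => (ht s hs).continuousAt.continuousWithinAt) fun s hs => by
      rw [interior_Ioo] at hs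
      rw [(ht s hs).deriv]
      exact hpos _ (htI s hs)
  have hmid : (α + β) / 2 ∈ Ioo α β := ⟨by linarith, by linarith⟩
  have hlI : l ∈ U.I := by
    refine mem_I_of_le hI (htI _ hmid) (ge_of_tendsto hl ?_)
    filter_upwards [Ioo_mem_nhdsLT hmid.2] with s hs
    exact (hmono hmid ⟨hmid.1.trans hs.1, hs.2⟩ hs.1).le
  obtain ⟨ψ, hψ0, hψ⟩ := exists_solution_of_continuousOn_of_pos U.isOpen_I hf hpos hlI
  obtain ⟨δ, hδ, hψ⟩ := Metric.eventually_nhds_iff.1 hψ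
  have hg : ∀ s ∈ Ico β (β + δ), ψ (s - β) ∈ U.I ∧
      HasDerivAt (fun s => ψ (s - β)) (f (ψ (s - β))) s := by
    intro s hs
    obtain ⟨h1, h2⟩ := hψ (y := s - β) (by
      rw [Real.dist_eq, sub_zero, abs_of_nonneg (sub_nonneg.2 hs.1)]
      linarith [hs.2])
    exact ⟨h1, h2.comp_sub_const s β⟩
  have hgβ : ψ (β - β) = l := by rw [sub_self, hψ0]
  have hglue := hasDerivAt_glue (V := fun _ r => f r) (f := t) (g := fun s => ψ (s - β))
    (a := α) (b := β) (c := β + δ) hαβ (by linarith)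
    (by
      have h1 : ContinuousAt f l := hf.continuousAt (U.isOpen_I.mem_nhds hlI)
      have h2 : ContinuousAt f ((β, ψ (β - β)) : ℝ × ℝ).2 := by simpa only [hgβ] using h1
      exact h2.comp (f := Prod.snd) continuousAt_snd)
    ht (by simpa only [hgβ] using hl) fun s hs => (hg s hs).2
  refine ⟨δ, hδ, fun u => if u < β then t u else ψ (u - β), fun s hs => if_pos hs.2,
    fun s hs => ⟨?_, hglue s hs⟩⟩
  by_cases h : s < β
  · simpa only [if_pos h] using htI s ⟨hs.1, h⟩
  · simpa only [if_neg h] using (hg s ⟨not_lt.1 h, hs.2⟩).1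

lemma IsGeodesicOn.contDiffAt (hγ : U.IsGeodesicOn γ (Ioo α β)) {s : ℝ} (hs : s ∈ Ioo α β) :
    ContDiffAt ℝ 1 (fun u => (γ u).1) s ∧ ContMDiffAt 𝓘(ℝ, ℝ) (𝓡 n) 1 (fun u => (γ u).2) s := by
  rw [isGeodesicOn_iff] at hγ
  have hev : ∀ᶠ u in 𝓝 s, u ∈ Ioo α β := isOpen_Ioo.mem_nhds hs
  exact ⟨contDiffAt_one_of_eventually (hev.mono fun u hu =>
      ⟨(hγ u hu).2.1.self_of_nhds, (hγ u hu).2.2.1.differentiableAt⟩),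
    contMDiffAt_of_dampedGeodesicAt (hev.mono fun u hu => (hγ u hu).2.2.2)⟩

/-- The spatial part of a geodesic, affinely reparametrized (backwards if `k < 0`), forms a causal
segment with each increasing time function `τ` which is fast enough. -/
lemma causalSegment_of_affine (hγ : U.IsGeodesicOn γ (Ioo α β)) {τ τ' : ℝ → ℝ} {s k : ℝ}
    (hs : ∀ u ∈ Icc (0 : ℝ) 1, s + u * k ∈ Ioo α β)
    (hτI : ∀ u ∈ Icc (0 : ℝ) 1, τ u ∈ U.I) (hτ : ∀ u ∈ Icc (0 : ℝ) 1, ContDiffAt ℝ 1 τ u)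
    (hτ' : ∀ u ∈ Icc (0 : ℝ) 1, HasDerivAt τ (τ' u) u) (hpos : ∀ u ∈ Icc (0 : ℝ) 1, 0 < τ' u)
    (hslow : ∀ u ∈ Icc (0 : ℝ) 1, U.a (τ u) ^ 2 *
      (k ^ 2 * speedSq U.σ (fun u => (γ u).2) (s + u * k)) ≤ τ' u ^ 2) :
    U.CausalSegment (τ 0, (γ s).2) (τ 1, (γ (s + k)).2) := by
  refine ⟨fun u => (τ u, (γ (s + u * k)).2), by simp, by simp, fun u hu => ?_⟩
  have hx := (hγ.contDiffAt (hs u hu)).2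
  have hℓ : ContDiffAt ℝ 1 (fun u : ℝ => s + u * k) u := by fun_prop
  refine ⟨hτI u hu, hτ u hu, ContMDiffAt.comp (g := fun v => (γ v).2)
    (f := fun u => s + u * k) u hx hℓ.contMDiffAt, ?_, ?_⟩
  · change 0 < deriv τ u
    rw [(hτ' u hu).deriv]
    exact hpos u hu
  · refine (lorentz_velocity U (fun u => (τ u, (γ (s + u * k)).2)) u).trans_le ?_
    change -(deriv τ u) ^ 2 + U.a (τ u) ^ 2
      * speedSq U.σ (fun u => (fun v => (γ v).2) (s + u * k)) u ≤ 0
    rw [speedSq_comp_affine (x := fun v => (γ v).2) (hx.mdifferentiableAt one_ne_zero),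
      (hτ' u hu).deriv]
    linarith [hslow u hu]

end Universe

/-! ### Confinement of causal geodesics -/

section Slice

variable {n : ℕ} {M : Type*} [TopologicalSpace M] [ChartedSpace (EuclideanSpace ℝ (Fin n)) M]
  [IsManifold (𝓡 n) ∞ M]

local notation "𝔼" => EuclideanSpace ℝ (Fin n)

/-- On compact subsets of a chart, the metric dominates the Euclidean one. -/
lemma exists_mul_norm_sq_le_chartMetric (σ : SliceMetric n M) {q : M} {B : Set 𝔼}
    (hB : IsCompact B) (hBt : B ⊆ (extChartAt (𝓡 n) q).target) :
    ∃ m > 0, ∀ y ∈ B, ∀ v, m * ‖v‖ ^ 2 ≤ chartMetric σ q y v v := by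
  have hcont : ContinuousOn (fun z : 𝔼 × 𝔼 => chartMetric σ q z.1 z.2 z.2)
      (B ×ˢ Metric.sphere 0 1) := by
    have h1 : ContinuousOn (fun z : 𝔼 × 𝔼 => chartMetric σ q z.1) (B ×ˢ Metric.sphere 0 1) :=
      ((contDiffOn_chartMetric σ q).continuousOn.mono hBt).comp continuousOn_fst
        fun z hz => hz.1
    exact (h1.clm_apply continuousOn_snd).clm_apply continuousOn_snd
  obtain ⟨m, hm, hmin⟩ := (hB.prod (isCompact_sphere (0 : 𝔼) 1)).exists_forall_le' hcont
    (a := 0) fun z hz => chartMetric_pos σ (hBt hz.1) fun h0 => by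
      have := hz.2
      simp [h0] at this
  refine ⟨m, hm, fun y hy v => ?_⟩
  rcases eq_or_ne v 0 with rfl | hv
  · simp
  · have hvn : ‖v‖ ≠ 0 := norm_ne_zero_iff.2 hv
    have h1 := hmin (y, ‖v‖⁻¹ • v) ⟨hy, by simp [norm_smul, hvn]⟩
    simp only [map_smul, smul_apply, smul_eq_mul] at h1
    have h2 : chartMetric σ q y v v
        = ‖v‖ ^ 2 * (‖v‖⁻¹ * (‖v‖⁻¹ * chartMetric σ q y v v)) := by
      field_simp
    rw [h2, mul_comm m]
    exact mul_le_mul_of_nonneg_left h1 (sq_nonneg _)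

/-- A curve of bounded speed which has a cluster point at the end of its domain is finally contained
in a compact coordinate ball. -/
lemma exists_forall_mem_closedBall [T2Space M] (σ : SliceMetric n M) {x : ℝ → M} {α β Q : ℝ}
    (hx : ∀ s ∈ Ioo α β, MDifferentiableAt 𝓘(ℝ, ℝ) (𝓡 n) x s)
    (hQ : ∀ s ∈ Ioo α β, speedSq σ x s ≤ Q) (hαβ : α < β) {q : M}
    (hq : MapClusterPt q (𝓝[<] β) x) :
    ∃ s₂ ∈ Ioo α β, ∃ (y₀ : 𝔼) (ρ : ℝ), Metric.closedBall y₀ ρ ⊆ (extChartAt (𝓡 n) q).target ∧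
      ∀ s ∈ Ico s₂ β, x s ∈ (extChartAt (𝓡 n) q).source ∧
        extChartAt (𝓡 n) q (x s) ∈ Metric.closedBall y₀ ρ := by
  set φ := extChartAt (𝓡 n) q with hφ
  set y₀ : 𝔼 := φ q with hy₀
  obtain ⟨ρ, hρ, hball⟩ := Metric.nhds_basis_closedBall.mem_iff.1 (extChartAt_target_mem_nhds
    (I := 𝓡 n) q)
  set A : Set M := φ.symm '' Metric.closedBall y₀ ρ with hA
  set O : Set M := φ.source ∩ φ ⁻¹' Metric.ball y₀ ρ with hO
  have hAc : IsClosed A := ((isCompact_closedBall y₀ ρ).image_of_continuousOn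
    ((continuousOn_extChartAt_symm q).mono hball)).isClosed
  have hAmem : ∀ p ∈ A, p ∈ φ.source ∧ φ p ∈ Metric.closedBall y₀ ρ := by
    rintro _ ⟨y, hy, rfl⟩
    exact ⟨φ.map_target (hball hy), by rwa [φ.right_inv (hball hy)]⟩
  have hOo : IsOpen O := (continuousOn_extChartAt q).isOpen_inter_preimage
    (isOpen_extChartAt_source q) Metric.isOpen_ball
  have hOA : O ⊆ A := fun p hp => ⟨φ p, Metric.ball_subset_closedBall hp.2, φ.left_inv hp.1⟩
  obtain ⟨m, hm, hmle⟩ := exists_mul_norm_sq_le_chartMetric σ (isCompact_closedBall y₀ ρ) hball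
  set L : ℝ := √(Q / m) with hL
  have hdiff : ∀ s ∈ Ioo α β, x s ∈ φ.source → DifferentiableAt ℝ (fun u => φ (x u)) s := by
    intro s hs hsrc
    have h1 := (mdifferentiableAt_extChartAt (I := 𝓡 n) (x := q)
      (by rwa [← extChartAt_source (𝓡 n)])).comp s (hx s hs)
    exact mdifferentiableAt_iff_differentiableAt.1 h1
  have hderiv : ∀ s ∈ Ioo α β, x s ∈ A → ‖deriv (fun u => φ (x u)) s‖ ≤ L := by
    intro s hs hsA
    obtain ⟨hsrc, hcb⟩ := hAmem _ hsA
    have h1 := speedSq_eq_chartMetric (σ := σ) (hx s hs).continuousAt hsrc (hdiff s hs hsrc)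
    have h2 := hmle _ hcb (deriv (fun u => φ (x u)) s)
    refine Real.le_sqrt_of_sq_le ?_
    rw [le_div_iff₀ hm, mul_comm]
    exact h2.trans (h1 ▸ hQ s hs)
  -- being a cluster point, `q` is approached so late that the remaining length is below `ρ / 2`
  have hlate : ∀ᶠ s in 𝓝[<] β, s ∈ Ioo α β ∧ L * (β - s) < ρ / 2 := by
    refine Filter.Eventually.and (Ioo_mem_nhdsLT hαβ) ?_
    have h1 : ContinuousAt (fun s => L * (β - s)) β := by fun_prop
    exact nhdsWithin_le_nhds (h1.eventually_lt continuousAt_const (by simpa using hρ))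
  have hfreq : ∃ᶠ s in 𝓝[<] β, x s ∈ φ.source ∩ φ ⁻¹' Metric.ball y₀ (ρ / 2) := by
    refine (mapClusterPt_iff_frequently.1 hq) _ ?_
    refine ((continuousOn_extChartAt q).isOpen_inter_preimage
      (isOpen_extChartAt_source q) Metric.isOpen_ball).mem_nhds ⟨mem_extChartAt_source q, ?_⟩
    exact Metric.mem_ball_self (half_pos hρ)
  obtain ⟨s₂, hs₂, hs₂I, hs₂L⟩ := (hfreq.and_eventually hlate).exists
  refine ⟨s₂, hs₂I, y₀, ρ, hball, fun s hs => hAmem _ (hOA ?_)⟩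
  by_contra hout
  have hxc : ContinuousOn x (Icc s₂ s) := fun u hu =>
    (hx u ⟨hs₂I.1.trans_le hu.1, hu.2.trans_lt hs.2⟩).continuousAt.continuousWithinAt
  -- consider the first parameter `s₃` at which the curve leaves the open ball
  have hN : IsCompact (Icc s₂ s ∩ x ⁻¹' Oᶜ) :=
    isCompact_Icc.of_isClosed_subset (hxc.preimage_isClosed_of_isClosed isClosed_Icc
      hOo.isClosed_compl) inter_subset_left
  obtain ⟨s₃, ⟨hs₃, hs₃O⟩, hleast⟩ := hN.exists_isLeast ⟨s, ⟨hs.1, le_rfl⟩, hout⟩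
  have hs₂O : x s₂ ∈ O := ⟨hs₂.1, Metric.ball_subset_ball (by linarith) hs₂.2⟩
  have hlt : s₂ < s₃ := hs₃.1.lt_of_ne fun h => hs₃O (h ▸ hs₂O)
  have hbefore : ∀ u ∈ Ico s₂ s₃, x u ∈ O := fun u hu => by
    by_contra h
    exact absurd (hleast ⟨⟨hu.1, hu.2.le.trans hs₃.2⟩, h⟩) (not_le.2 hu.2)
  have hI₃ : ∀ u ∈ Icc s₂ s₃, u ∈ Ioo α β := fun u hu =>
    ⟨hs₂I.1.trans_le hu.1, (hu.2.trans hs₃.2).trans_lt hs.2⟩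
  have hs₃A : x s₃ ∈ A := by
    have h1 : Tendsto x (𝓝[<] s₃) (𝓝 (x s₃)) :=
      (hx s₃ (hI₃ s₃ ⟨hlt.le, le_rfl⟩)).continuousAt.tendsto.mono_left nhdsWithin_le_nhds
    refine hAc.mem_of_tendsto h1 ?_
    filter_upwards [Ioo_mem_nhdsLT hlt] with u hu using hOA (hbefore u ⟨hu.1.le, hu.2⟩)
  have hallA : ∀ u ∈ Icc s₂ s₃, x u ∈ A := fun u hu => by
    rcases hu.2.lt_or_eq with h | h
    · exact hOA (hbefore u ⟨hu.1, h⟩)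
    · exact h ▸ hs₃A
  have hmv := (convex_Icc s₂ s₃).norm_image_sub_le_of_norm_deriv_le (𝕜 := ℝ)
    (f := fun u => φ (x u)) (C := L)
    (fun u hu => hdiff u (hI₃ u hu) (hAmem _ (hallA u hu)).1)
    (fun u hu => hderiv u (hI₃ u hu) (hallA u hu)) ⟨le_rfl, hlt.le⟩ ⟨hlt.le, le_rfl⟩
  refine hs₃O ⟨(hAmem _ hs₃A).1, ?_⟩
  have h2 : ‖φ (x s₂) - y₀‖ < ρ / 2 := mem_ball_iff_norm.1 hs₂.2
  have h3 : L * ‖s₃ - s₂‖ ≤ L * (β - s₂) := by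
    rw [Real.norm_of_nonneg (by linarith)]
    exact mul_le_mul_of_nonneg_left (by linarith [hs₃.2, hs.2]) (Real.sqrt_nonneg _)
  have h4 : φ (x s₃) - y₀ = (φ (x s₃) - φ (x s₂)) + (φ (x s₂) - y₀) := by abel
  change φ (x s₃) ∈ Metric.ball y₀ ρ
  rw [mem_ball_iff_norm, h4]
  exact (norm_add_le _ _).trans_lt (by linarith)

end Slice

namespace Universe

variable {n : ℕ} {M : Type*} [TopologicalSpace M] [ChartedSpace (EuclideanSpace ℝ (Fin n)) M]
  [IsManifold (𝓡 n) ∞ M] {U : Universe n M} {γ : ℝ → ℝ × M} {α β : ℝ}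

/-- The end of a causal geodesic defined up to a finite parameter value lies in a causal diamond:
from a late point of it, its spatial part can be run backwards in at least one unit of time, which
is a causal curve as the remaining spatial length is small. -/
lemma exists_isCompact_of_globallyHyperbolic (hgh : U.GloballyHyperbolic)
    (hI : ¬ BddAbove U.I) (hγ : U.IsGeodesicOn γ (Ioo α β)) (hαβ : α < β)
    (hc : ∀ s ∈ Ioo α β, U.FutureCausalAt γ s) {Q : ℝ}
    (hQ : ∀ s ∈ Ioo α β, speedSq U.σ (fun u => (γ u).2) s ≤ Q) {b : ℝ}
    (hb : ∀ s ∈ Ioo α β, (γ s).1 ≤ b) :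
    ∃ s₁ ∈ Ioo α β, ∃ K, IsCompact K ∧ ∀ s ∈ Ioo s₁ β, γ s ∈ K := by
  set t : ℝ → ℝ := fun u => (γ u).1 with ht
  set x : ℝ → M := fun u => (γ u).2 with hx
  have htI : ∀ s ∈ Ioo α β, t s ∈ U.I := fun s hs => (hγ s hs).1
  have hdt : ∀ s ∈ Ioo α β, HasDerivAt t (deriv t s) s := fun s hs =>
    ((hγ.contDiffAt hs).1.differentiableAt one_ne_zero).hasDerivAt
  have htpos : ∀ s ∈ Ioo α β, 0 < deriv t s := fun s hs => (hc s hs).1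
  have hmono : StrictMonoOn t (Ioo α β) := strictMonoOn_of_deriv_pos (convex_Ioo α β)
    (fun s hs => (hdt s hs).continuousAt.continuousWithinAt) fun s hs => by
      rw [interior_Ioo] at hs
      exact htpos s hs
  -- `A` bounds the scale factor during the time from `t s₀` to one unit after the end
  set s₀ := (α + β) / 2 with hs₀
  have hmid : s₀ ∈ Ioo α β := ⟨by linarith, by linarith⟩
  have hsub : Icc (t s₀) (b + 1) ⊆ U.I := fun r hr => mem_I_of_le hI (htI _ hmid) hr.1
  obtain ⟨A, hA⟩ := isCompact_Icc.exists_bound_of_continuousOn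
    (U.differentiableOn_a.continuousOn.mono hsub)
  have hsmall : ∀ᶠ s in 𝓝[<] β, s ∈ Ioo s₀ β ∧ A ^ 2 * ((β - s) ^ 2 * Q) < 1 := by
    refine Filter.Eventually.and (Ioo_mem_nhdsLT hmid.2) ?_
    have h1 : ContinuousAt (fun s => A ^ 2 * ((β - s) ^ 2 * Q)) β := by fun_prop
    exact nhdsWithin_le_nhds (h1.eventually_lt continuousAt_const (by simp))
  obtain ⟨s₁, hs₁, hs₁small⟩ := hsmall.exists
  have hs₁I : s₁ ∈ Ioo α β := ⟨hmid.1.trans hs₁.1, hs₁.2⟩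
  refine ⟨s₁, hs₁I, U.causalDiamond (γ s₁) (b + 1, x s₁), hgh.2 _ (htI s₁ hs₁I) _
    (mem_I_of_le hI (htI s₁ hs₁I) (by linarith [hb s₁ hs₁I])), fun s hs => ?_⟩
  have hsI : s ∈ Ioo α β := ⟨hs₁I.1.trans hs.1, hs.2⟩
  constructor
  -- the geodesic itself leads from `γ s₁` to `γ s`
  · refine Relation.ReflTransGen.single ?_
    have hu : ∀ u ∈ Icc (0 : ℝ) 1, s₁ + u * (s - s₁) ∈ Ioo α β := fun u hu => by
      have h1 : 0 ≤ u * (s - s₁) := mul_nonneg hu.1 (by linarith [hs.1])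
      have h2 : u * (s - s₁) ≤ 1 * (s - s₁) :=
        mul_le_mul_of_nonneg_right hu.2 (by linarith [hs.1])
      exact ⟨by linarith [hs₁I.1], by linarith [hs.2]⟩
    have hd : ∀ u ∈ Icc (0 : ℝ) 1, HasDerivAt (fun u => t (s₁ + u * (s - s₁)))
        (deriv t (s₁ + u * (s - s₁)) * (s - s₁)) u := fun u hu' => by
      have hℓ : HasDerivAt (fun u : ℝ => s₁ + u * (s - s₁)) (s - s₁) u := by
        simpa using ((hasDerivAt_id u).mul_const (s - s₁)).const_add s₁
      exact (hdt _ (hu u hu')).comp u hℓ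
    have h := causalSegment_of_affine hγ (τ := fun u => t (s₁ + u * (s - s₁))) (s := s₁)
      (k := s - s₁) hu (fun u hu' => htI _ (hu u hu'))
      (fun u hu' => ContDiffAt.comp (g := t) (f := fun u : ℝ => s₁ + u * (s - s₁)) u
        (hγ.contDiffAt (hu u hu')).1 (by fun_prop))
      hd (fun u hu' => mul_pos (htpos _ (hu u hu')) (sub_pos.2 hs.1)) fun u hu' => by
        have h1 := (hc _ (hu u hu')).2
        rw [lorentz_velocity] at h1
        have h2 : U.a (t (s₁ + u * (s - s₁))) ^ 2 * speedSq U.σ x (s₁ + u * (s - s₁))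
          ≤ deriv t (s₁ + u * (s - s₁)) ^ 2 := by linarith
        have h3 := mul_le_mul_of_nonneg_right h2 (sq_nonneg (s - s₁))
        linarith
    simpa [ht] using h
  -- from `γ s`, go back along `x` to `x s₁` while time increases uniformly to `b + 1`
  · refine Relation.ReflTransGen.single ?_
    have hu : ∀ u ∈ Icc (0 : ℝ) 1, s + u * (s₁ - s) ∈ Ioo α β := fun u hu => by
      have h1 : 0 ≤ u * (s - s₁) := mul_nonneg hu.1 (by linarith [hs.1])
      have h2 : u * (s - s₁) ≤ 1 * (s - s₁) :=
        mul_le_mul_of_nonneg_right hu.2 (by linarith [hs.1])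
      have h3 : u * (s₁ - s) = -(u * (s - s₁)) := by ring
      exact ⟨by linarith [hs₁I.1], by linarith [hs.2]⟩
    have hgap : 1 ≤ b + 1 - t s := by linarith [hb s hsI]
    have hrange : ∀ u ∈ Icc (0 : ℝ) 1, t s + u * (b + 1 - t s) ∈ Icc (t s₀) (b + 1) :=
      fun u hu => by
        have h0 : t s₀ ≤ t s := (hmono hmid hsI (hs₁.1.trans hs.1)).le
        have h1 : 0 ≤ u * (b + 1 - t s) := mul_nonneg hu.1 (by linarith)
        have h2 : u * (b + 1 - t s) ≤ 1 * (b + 1 - t s) :=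
          mul_le_mul_of_nonneg_right hu.2 (by linarith)
        exact ⟨by linarith, by linarith⟩
    have h := causalSegment_of_affine hγ (τ := fun u => t s + u * (b + 1 - t s))
      (τ' := fun _ => b + 1 - t s) (s := s)
      (k := s₁ - s) hu (fun u hu' => hsub (hrange u hu')) (fun u hu' => by fun_prop)
      (fun u hu' => by
        simpa using ((hasDerivAt_id u).mul_const (b + 1 - t s)).const_add (t s))
      (fun u hu' => by linarith) fun u hu' => by
        have h1 : U.a (t s + u * (b + 1 - t s)) ^ 2 ≤ A ^ 2 := by
          rw [← sq_abs, ← Real.norm_eq_abs]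
          exact pow_le_pow_left₀ (norm_nonneg _) (hA _ (hrange u hu')) 2
        have h2 : (s₁ - s) ^ 2 ≤ (β - s₁) ^ 2 := by
          nlinarith [hs.1, hs.2]
        have h3 := hQ _ (hu u hu')
        have h4 := speedSq_nonneg U.σ x (s + u * (s₁ - s))
        have h5 : (s₁ - s) ^ 2 * speedSq U.σ x (s + u * (s₁ - s)) ≤ (β - s₁) ^ 2 * Q :=
          mul_le_mul h2 h3 h4 (sq_nonneg _)
        have h6 := mul_le_mul h1 h5 (mul_nonneg (sq_nonneg _) h4) (sq_nonneg A)
        have h7 : (1 : ℝ) ≤ (b + 1 - t s) ^ 2 := one_le_pow₀ hgap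
        linarith
    simpa [ht, hx] using h

end Universe

/-! ### Continuation of causal geodesics -/

section Slice

variable {n : ℕ} {M : Type*} [TopologicalSpace M] [ChartedSpace (EuclideanSpace ℝ (Fin n)) M]
  [IsManifold (𝓡 n) ∞ M]

local notation "𝔼" => EuclideanSpace ℝ (Fin n)

/-- The geodesic spray of the slice metric in the preferred chart at `q`: the vector field
`(y, p) ↦ (p, -Γ_y(p, p))`. -/
def spray (σ : SliceMetric n M) (q : M) (z : 𝔼 × 𝔼) : 𝔼 × 𝔼 :=
  (z.2, -christoffel (chartMetric σ q) z.1 z.2 z.2)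

variable {σ : SliceMetric n M} {q : M}

lemma contDiffAt_spray {z : 𝔼 × 𝔼} (hz : z.1 ∈ (extChartAt (𝓡 n) q).target) :
    ContDiffAt ℝ 1 (spray σ q) z :=
  contDiffAt_snd.prodMk (contDiffAt_christoffel
    ((contDiffAt_chartMetric σ hz).of_le (by norm_cast)) (isInvertible_chartMetric σ hz)).neg

lemma hasDerivAt_chartMetric_of_spray {Z : ℝ → 𝔼 × 𝔼} {b s : ℝ}
    (hz : (Z s).1 ∈ (extChartAt (𝓡 n) q).target) (hZ : HasDerivAt Z (b • spray σ q (Z s)) s) :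
    HasDerivAt (fun u => chartMetric σ q (Z u).1 (Z u).2 (Z u).2) 0 s := by
  have h1 : HasDerivAt (fun u => (Z u).1) (b • (Z s).2) s := hZ.fst
  have h2 : HasDerivAt (fun u => (Z u).2)
      (b • -christoffel (chartMetric σ q) (Z s).1 (Z s).2 (Z s).2) s := hZ.snd
  exact hasDerivAt_norm_sq_eq_zero (differentiableAt_chartMetric σ hz) (chartMetric_symm σ q _)
    (isInvertible_chartMetric σ hz) h1 (h2.congr_deriv (smul_neg _ _))

end Slice

namespace Universe

variable {n : ℕ} {M : Type*} [TopologicalSpace M] [ChartedSpace (EuclideanSpace ℝ (Fin n)) M]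
  [IsManifold (𝓡 n) ∞ M] {U : Universe n M} {γ γ' : ℝ → ℝ × M} {α β s : ℝ}

local notation "𝔼" => EuclideanSpace ℝ (Fin n)

lemma IsGeodesicOn.congr_singleton (h : U.IsGeodesicOn γ {s}) (he : γ' =ᶠ[𝓝 s] γ) :
    U.IsGeodesicOn γ' {s} := by
  rintro s rfl
  obtain ⟨h1, h2, h3, h4⟩ := h _ rfl
  have hs : γ' s = γ s := he.self_of_nhds
  rw [hs]
  have hce : (fun u => ((γ' u).1, extChartAt (𝓡 n) (γ s).2 (γ' u).2))
      =ᶠ[𝓝 s] fun u => ((γ u).1, extChartAt (𝓡 n) (γ s).2 (γ u).2) :=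
    he.fun_comp fun z => (z.1, extChartAt (𝓡 n) (γ s).2 z.2)
  refine ⟨h1, h2.congr he.symm, ?_, ?_⟩
  · filter_upwards [h3, hce.eventuallyEq_nhds] with u hu hu'
    exact hu.congr_of_eventuallyEq hu'
  · rw [hce.deriv.self_of_nhds]
    exact (h4.congr_of_eventuallyEq hce.deriv).congr_deriv (by simp only [hs])

/-- Solutions of the first-order system for the time, the position and the momentum are
geodesics. -/
lemma isGeodesicOn_singleton_of_spray {q : M} {T : ℝ → ℝ} {Z : ℝ → 𝔼 × 𝔼} {C e : ℝ}
    (hγ : ∀ᶠ u in 𝓝 s, γ u = (T u, (extChartAt (𝓡 n) q).symm (Z u).1))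
    (hI : T s ∈ U.I) (hpos : 0 < e + C / U.a (T s) ^ 2)
    (hT : ∀ᶠ u in 𝓝 s, HasDerivAt T √(e + C / U.a (T u) ^ 2) u)
    (htar : ∀ᶠ u in 𝓝 s, (Z u).1 ∈ (extChartAt (𝓡 n) q).target)
    (hZ : ∀ᶠ u in 𝓝 s, HasDerivAt Z ((U.a (T u) ^ 2)⁻¹ • spray U.σ q (Z u)) u)
    (hC : chartMetric U.σ q (Z s).1 (Z s).2 (Z s).2 = C) : U.IsGeodesicOn γ {s} := by
  rw [isGeodesicOn_iff]
  rintro s rfl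
  have ha : 0 < U.a (T s) := U.a_pos _ hI
  have ht : (fun u => (γ u).1) =ᶠ[𝓝 s] T := hγ.mono fun u hu => by simp only [hu]
  have hx : (fun u => (γ u).2) =ᶠ[𝓝 s] fun u => (extChartAt (𝓡 n) q).symm (Z u).1 :=
    hγ.mono fun u hu => by simp only [hu]
  have hts : (γ s).1 = T s := ht.self_of_nhds
  have hxs : (γ s).2 = (extChartAt (𝓡 n) q).symm (Z s).1 := hx.self_of_nhds
  have hsrc : (γ s).2 ∈ (extChartAt (𝓡 n) q).source := by
    rw [hxs]
    exact (extChartAt (𝓡 n) q).map_target htar.self_of_nhds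
  have hy : (fun u => extChartAt (𝓡 n) q (γ u).2) =ᶠ[𝓝 s] fun u => (Z u).1 := by
    filter_upwards [hγ, htar] with u hu hu'
    simp only [hu, (extChartAt (𝓡 n) q).right_inv hu']
  have hZ1 : ∀ᶠ u in 𝓝 s, HasDerivAt (fun u => (Z u).1) ((U.a (T u) ^ 2)⁻¹ • (Z u).2) u :=
    hZ.mono fun u hu => hu.fst
  have hyd : ∀ᶠ u in 𝓝 s, HasDerivAt (fun u => extChartAt (𝓡 n) q (γ u).2)
      ((U.a (T u) ^ 2)⁻¹ • (Z u).2) u := by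
    filter_upwards [hZ1, hy.eventuallyEq_nhds] with u h1 h2 using h1.congr_of_eventuallyEq h2
  have hydd : deriv (fun u => extChartAt (𝓡 n) q (γ u).2)
      =ᶠ[𝓝 s] fun u => (U.a (T u) ^ 2)⁻¹ • (Z u).2 := hyd.mono fun u hu => hu.deriv
  have htd : deriv (fun u => (γ u).1) =ᶠ[𝓝 s] fun u => √(e + C / U.a (T u) ^ 2) := by
    filter_upwards [hT, ht.eventuallyEq_nhds] with u h1 h2
    exact (h1.congr_of_eventuallyEq h2).deriv
  have hxc : ContinuousAt (fun u => (γ u).2) s := by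
    refine ContinuousAt.congr ?_ hx.symm
    exact ContinuousAt.comp (g := (extChartAt (𝓡 n) q).symm) (f := fun u => (Z u).1)
      (continuousAt_extChartAt_symm'' htar.self_of_nhds) hZ1.self_of_nhds.continuousAt
  have hspeed : speedSq U.σ (fun u => (γ u).2) s = C / U.a (T s) ^ 4 := by
    rw [speedSq_eq_chartMetric hxc hsrc hyd.self_of_nhds.differentiableAt, hydd.self_of_nhds]
    have hys : extChartAt (𝓡 n) q (γ s).2 = (Z s).1 := hy.self_of_nhds
    rw [hys, ← hC]
    simp only [map_smul, smul_apply, smul_eq_mul]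
    field_simp
  have haT : HasDerivAt (fun u => U.a (T u)) (deriv U.a (T s) * √(e + C / U.a (T s) ^ 2)) s :=
    (U.differentiableAt_a hI).hasDerivAt.comp s hT.self_of_nhds
  rw [hts, hspeed]
  refine ⟨hI, ?_, ?_, q, hsrc, hxc, hyd.mono fun u hu => hu.differentiableAt, ?_⟩
  · filter_upwards [hT, ht.eventuallyEq_nhds] with u h1 h2
    exact (h1.congr_of_eventuallyEq h2).differentiableAt
  · refine HasDerivAt.congr_of_eventuallyEq ?_ htd
    have h1 : HasDerivAt (fun u => e + C * (U.a (T u) ^ 2)⁻¹) _ s :=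
      (((haT.pow 2).inv (pow_pos ha 2).ne').const_mul C).const_add e
    have h2 : HasDerivAt (fun u => √(e + C * (U.a (T u) ^ 2)⁻¹)) _ s :=
      h1.sqrt (by rw [← div_eq_mul_inv]; exact hpos.ne')
    simp only [← div_eq_mul_inv C] at h2
    refine h2.congr_deriv ?_
    have hsq := Real.sqrt_pos.2 hpos
    simp only [Pi.pow_apply]
    generalize √(e + C / U.a (T s) ^ 2) = w at hsq
    field_simp
    norm_num
    ring
  · refine HasDerivAt.congr_of_eventuallyEq ?_ hydd
    have hys : extChartAt (𝓡 n) q (γ s).2 = (Z s).1 := hy.self_of_nhds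
    have hZ2 : HasDerivAt (fun u => (Z u).2) ((U.a (T s) ^ 2)⁻¹ •
        -christoffel (chartMetric U.σ q) (Z s).1 (Z s).2 (Z s).2) s := hZ.self_of_nhds.snd
    have h1 : HasDerivAt (fun u => (U.a (T u) ^ 2)⁻¹ • (Z u).2) _ s :=
      ((haT.pow 2).inv (pow_pos ha 2).ne').smul hZ2
    refine h1.congr_deriv ?_
    rw [hydd.self_of_nhds, htd.self_of_nhds, hys, christoffel_smul, smul_smul, smul_neg, smul_smul,
      sub_eq_add_neg]
    congr 1
    · congr 2
      simp only [Pi.inv_apply, Pi.pow_apply]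
      ring
    · rw [← neg_smul]
      congr 1
      simp only [hubble, Pi.pow_apply]
      generalize √(e + C / U.a (T s) ^ 2) = w
      field_simp
      norm_num
      ring

/-- If time does not end, then the causal geodesics can be continued. -/
lemma not_futureIncomplete [T2Space M] (hgh : U.GloballyHyperbolic) (hrh : U.RegularlyHyperbolic)
    (hI : ¬ BddAbove U.I) : ¬ U.FutureIncomplete := by
  rintro ⟨γ, α, β, hαβ, hγ, hc, hno⟩
  apply hno
  obtain ⟨C, e, hC, he, hpos, hint⟩ := hγ.first_integrals hαβ hc
  obtain ⟨c, hc0, hca⟩ := hrh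
  set f : ℝ → ℝ := fun r => √(e + C / U.a r ^ 2) with hf
  set x : ℝ → M := fun u => (γ u).2 with hx
  have hγI : ∀ s ∈ Ioo α β, (γ s).1 ∈ U.I := fun s hs => (hγ s hs).1
  have hfpos : ∀ r ∈ U.I, 0 < f r := fun r hr => Real.sqrt_pos.2 (hpos _ (U.a_pos r hr))
  have hacont := U.differentiableOn_a.continuousOn
  have hfcont : ContinuousOn f U.I :=
    (continuousOn_const.add (continuousOn_const.div (hacont.pow 2)
      fun r hr => (pow_pos (U.a_pos r hr) 2).ne')).sqrt
  have hfB : ∀ r ∈ U.I, f r ≤ √(e + C / c ^ 2) := fun r hr => by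
    have := hca r hr
    exact Real.sqrt_le_sqrt (by gcongr)
  obtain ⟨δ, hδ, T, hTeq, hT⟩ := exists_time_extension hI hαβ hfcont hfpos hfB hγI
    fun s hs => (hint s hs).2
  have hTcont : ContinuousOn T (Ioo α (β + δ)) := fun s hs =>
    (hT s hs).2.continuousAt.continuousWithinAt
  have hTmono : StrictMonoOn T (Ioo α (β + δ)) :=
    strictMonoOn_of_deriv_pos (convex_Ioo _ _) hTcont fun s hs => by
      rw [interior_Ioo] at hs
      rw [(hT s hs).2.deriv]
      exact hfpos _ (hT s hs).1
  have hβ : β ∈ Ioo α (β + δ) := ⟨hαβ, by linarith⟩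
  have hIoo : ∀ s ∈ Ioo α β, s ∈ Ioo α (β + δ) := fun s hs => ⟨hs.1, by linarith [hs.2]⟩
  have hTle : ∀ s ∈ Ioo α β, (γ s).1 ≤ T β := fun s hs => by
    have h1 := (hTmono (hIoo s hs) hβ hs.2).le
    rwa [hTeq hs] at h1
  have hQ : ∀ s ∈ Ioo α β, speedSq U.σ x s ≤ C / c ^ 4 := fun s hs => by
    rw [le_div_iff₀ (pow_pos hc0 4), ← (hint s hs).1, mul_comm]
    exact mul_le_mul_of_nonneg_right (pow_le_pow_left₀ hc0.le (hca _ (hγI s hs)) 4)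
      (speedSq_nonneg _ _ _)
  -- the geodesic approaches some point `q` of the slice, and ends in the chart at `q`
  obtain ⟨s₁, hs₁, K, hK, hKmem⟩ :=
    exists_isCompact_of_globallyHyperbolic hgh hI hγ hαβ hc hQ hTle
  obtain ⟨⟨_, q⟩, -, hq⟩ := hK.exists_clusterPt (f := map γ (𝓝[<] β)) <| by
    rw [le_principal_iff, mem_map]
    filter_upwards [Ioo_mem_nhdsLT hs₁.2] with s hs using hKmem s hs
  have hq' : MapClusterPt q (𝓝[<] β) x :=
    MapClusterPt.continuousAt_comp (F := 𝓝[<] β) (u := γ) (f := Prod.snd) continuousAt_snd hq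
  obtain ⟨s₂, hs₂, y₀, ρ, hball, htrap⟩ := exists_forall_mem_closedBall U.σ
    (fun s hs => (hγ.contDiffAt hs).2.mdifferentiableAt one_ne_zero) hQ hαβ hq'
  obtain ⟨m, hm, hmle⟩ := exists_mul_norm_sq_le_chartMetric U.σ (isCompact_closedBall y₀ ρ) hball
  set φ := extChartAt (𝓡 n) q with hφ
  set b : ℝ → ℝ := fun s => (U.a (T s) ^ 2)⁻¹ with hb
  have hbcont : ContinuousOn b (Ioo α (β + δ)) :=
    ((hacont.comp hTcont fun s hs => (hT s hs).1).pow 2).inv₀ fun s hs =>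
      (pow_pos (U.a_pos _ (hT s hs).1) 2).ne'
  -- position and momentum `a² x'` in the chart solve a first-order system
  set Z : ℝ → 𝔼 × 𝔼 := fun s => (φ (x s), U.a (γ s).1 ^ 2 • deriv (fun u => φ (x u)) s) with hZ
  have hs₂β : ∀ s ∈ Ioo s₂ β, s ∈ Ioo α β := fun s hs => ⟨hs₂.1.trans hs.1, hs.2⟩
  have hgeo := (isGeodesicOn_iff U γ (Ioo α β)).1 hγ
  have hdamped : ∀ s ∈ Ioo s₂ β,
      DampedGeodesicAt U.σ (U.hubble (γ s).1 * deriv (fun u => (γ u).1) s) x q s := fun s hs => by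
    obtain ⟨q', hq'⟩ := (hgeo s (hs₂β s hs)).2.2.2
    exact hq'.change_chart (htrap s ⟨hs.1.le, hs.2⟩).1
  have hZd : ∀ s ∈ Ioo s₂ β, HasDerivAt Z (b s • spray U.σ q (Z s)) s := by
    intro s hs
    have hsI := hs₂β s hs
    have hapos := U.a_pos _ (hγI s hsI)
    have hA : HasDerivAt (fun u => U.a (γ u).1)
        (U.hubble (γ s).1 * deriv (fun u => (γ u).1) s * U.a (γ s).1) s := by
      have h1 := (U.differentiableAt_a (hγI s hsI)).hasDerivAt.comp s
        (hgeo s hsI).2.1.self_of_nhds.hasDerivAt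
      refine h1.congr_deriv ?_
      rw [U.deriv_a_eq (hγI s hsI)]
      ring
    have h2 := (hdamped s hs).hasDerivAt_momentum hA hapos.ne'
    have h3 := (hdamped s hs).2.2.1.self_of_nhds.hasDerivAt
    have hbs : b s = (U.a (γ s).1 ^ 2)⁻¹ := by simp only [hb, hTeq hsI]
    refine (h3.prodMk h2).congr_deriv (Prod.ext ?_ ?_)
    · simp only [hbs, spray, hZ, Prod.smul_fst, smul_smul]
      rw [inv_mul_cancel₀ (pow_pos hapos 2).ne', one_smul]
    · simp only [hbs, spray, hZ, Prod.smul_snd, smul_neg, hφ]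
  have hZC : ∀ s ∈ Ioo s₂ β, chartMetric U.σ q (Z s).1 (Z s).2 (Z s).2 = C := by
    intro s hs
    rw [← (hint s (hs₂β s hs)).1, speedSq_eq_chartMetric (hdamped s hs).2.1 (hdamped s hs).1
      (hdamped s hs).2.2.1.self_of_nhds]
    simp only [hZ, map_smul, smul_apply, smul_eq_mul]
    ring
  -- the phase space trajectory stays in a compact set, hence converges
  set P : Set (𝔼 × 𝔼) := Metric.closedBall y₀ ρ ×ˢ Metric.closedBall 0 √(C / m) with hP
  have hPc : IsCompact P := (isCompact_closedBall _ _).prod (isCompact_closedBall _ _)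
  have hZP : ∀ s ∈ Ioo s₂ β, Z s ∈ P := fun s hs => by
    have h1 := (htrap s ⟨hs.1.le, hs.2⟩).2
    refine ⟨h1, mem_closedBall_zero_iff.2 (Real.le_sqrt_of_sq_le ?_)⟩
    rw [le_div_iff₀ hm, mul_comm, ← hZC s hs]
    exact hmle _ h1 _
  obtain ⟨G, hG⟩ := hPc.exists_bound_of_continuousOn (f := spray U.σ q) fun z hz =>
    (contDiffAt_spray (hball hz.1)).continuousAt.continuousWithinAt
  obtain ⟨l, hl⟩ := exists_tendsto_of_norm_deriv_le hs₂.2 hZd (C := (c ^ 2)⁻¹ * G) fun s hs => by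
    have hsI := hT s (hIoo s (hs₂β s hs))
    have h1 : 0 < U.a (T s) ^ 2 := pow_pos (U.a_pos _ hsI.1) 2
    rw [norm_smul, Real.norm_of_nonneg (inv_pos.2 h1).le]
    refine mul_le_mul ?_ (hG _ (hZP s hs)) (norm_nonneg _) (inv_pos.2 (pow_pos hc0 2)).le
    exact inv_anti₀ (pow_pos hc0 2) (pow_le_pow_left₀ hc0.le (hca _ hsI.1) 2)
  have hlP : l ∈ P := hPc.isClosed.mem_of_tendsto hl <| by
    filter_upwards [Ioo_mem_nhdsLT hs₂.2] with s hs using hZP s hs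
  have hltar : l.1 ∈ φ.target := hball hlP.1
  obtain ⟨ζ, hζ0, ε, hε, hζ⟩ := (contDiffAt_spray (σ := U.σ)
    hltar).exists_forall_mem_closedBall_exists_eq_forall_mem_Ioo_hasDerivAt₀ 0
  -- the geodesic of the slice is reparametrized by `τ`, with `τ' = a⁻²`
  set τ : ℝ → ℝ := fun s => ∫ u in β..s, b u with hτ
  have hτd : ∀ s ∈ Ioo α (β + δ), HasDerivAt τ (b s) s := fun s hs =>
    (intervalIntegral.integral_hasStrictDerivAt_right
      ((hbcont.mono (ordConnected_Ioo.uIcc_subset hβ hs)).intervalIntegrable)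
      (hbcont.stronglyMeasurableAtFilter isOpen_Ioo s hs)
      (hbcont.continuousAt (isOpen_Ioo.mem_nhds hs))).hasDerivAt
  have hτβ : τ β = 0 := intervalIntegral.integral_same
  have hζτ : ζ (τ β) = l := by rw [hτβ, hζ0]
  have hev : ∀ᶠ s in 𝓝 β, s < β + δ ∧ τ s ∈ Ioo (0 - ε) (0 + ε) ∧ (ζ (τ s)).1 ∈ φ.target := by
    have h1 := (hτd β hβ).continuousAt
    have h2 : ContinuousAt (fun s => (ζ (τ s)).1) β := by
      refine continuousAt_fst.comp (ContinuousAt.comp (g := ζ) ?_ h1)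
      rw [hτβ]
      exact (hζ 0 ⟨by linarith, by linarith⟩).continuousAt
    refine (show ∀ᶠ s in 𝓝 β, s < β + δ from Iio_mem_nhds hβ.2).and (Filter.Eventually.and ?_ ?_)
    · exact h1.preimage_mem_nhds (by rw [hτβ]; exact Ioo_mem_nhds (by linarith) (by linarith))
    · exact h2.preimage_mem_nhds
        ((isOpen_extChartAt_target q).mem_nhds (by rw [hζτ]; exact hltar))
  obtain ⟨δ', hδ', hnear⟩ := Metric.eventually_nhds_iff.1 hev
  have hright : ∀ s ∈ Ico β (β + δ'),
      s < β + δ ∧ τ s ∈ Ioo (0 - ε) (0 + ε) ∧ (ζ (τ s)).1 ∈ φ.target := fun s hs =>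
    hnear (by rw [Real.dist_eq, abs_of_nonneg (by linarith [hs.1])]; linarith [hs.2])
  have hglue := hasDerivAt_glue (V := fun s z => b s • spray U.σ q z) (f := Z)
    (g := fun s => ζ (τ s)) (a := s₂) (b := β) (c := β + δ') hs₂.2 (by linarith)
    (by
      have h1 : ContinuousAt b ((β, ζ (τ β)) : ℝ × 𝔼 × 𝔼).1 :=
        hbcont.continuousAt (isOpen_Ioo.mem_nhds hβ)
      have h2 : ContinuousAt (spray U.σ q) ((β, ζ (τ β)) : ℝ × 𝔼 × 𝔼).2 := by
        simp only [hζτ]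
        exact (contDiffAt_spray hltar).continuousAt
      exact (h1.comp (f := Prod.fst) continuousAt_fst).smul
        (h2.comp (f := Prod.snd) continuousAt_snd))
    hZd (by simpa only [hζτ] using hl)
    (fun s hs => by
      obtain ⟨h1, h2, -⟩ := hright s hs
      exact (hζ _ h2).scomp s (hτd s ⟨hαβ.trans_le hs.1, h1⟩))
  set Z' : ℝ → 𝔼 × 𝔼 := fun s => if s < β then Z s else ζ (τ s) with hZ'
  have hZ'Z : ∀ s < β, Z' s = Z s := fun s hs => if_pos hs
  have hZ'tar : ∀ s ∈ Ioo s₂ (β + δ'), (Z' s).1 ∈ φ.target := by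
    intro s hs
    rcases lt_or_ge s β with h | h
    · rw [hZ'Z s h]
      exact hball (hZP s ⟨hs.1, h⟩).1
    · simp only [hZ', if_neg (not_lt.2 h)]
      exact (hright s ⟨h, hs.2⟩).2.2
  have hZ'C : ∀ s ∈ Ioo s₂ (β + δ'), chartMetric U.σ q (Z' s).1 (Z' s).2 (Z' s).2 = C := by
    have h0 : ∀ s ∈ Ioo s₂ (β + δ'),
        HasDerivAt (fun u => chartMetric U.σ q (Z' u).1 (Z' u).2 (Z' u).2) 0 s := fun s hs =>
      hasDerivAt_chartMetric_of_spray (hZ'tar s hs) (hglue s hs)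
    obtain ⟨C', hC'⟩ := isOpen_Ioo.exists_is_const_of_deriv_eq_zero isPreconnected_Ioo
      (fun s hs => (h0 s hs).differentiableAt.differentiableWithinAt) fun s hs => (h0 s hs).deriv
    have hmid : (s₂ + β) / 2 ∈ Ioo s₂ β := ⟨by linarith [hs₂.2], by linarith [hs₂.2]⟩
    have h1 := hC' _ ⟨hmid.1, by linarith [hmid.2]⟩
    rw [hZ'Z _ hmid.2, hZC _ hmid] at h1
    intro s hs
    rw [hC' s hs, ← h1]
  set γ' : ℝ → ℝ × M := fun s => if s < β then γ s else (T s, φ.symm (ζ (τ s)).1) with hγ'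
  refine ⟨γ', β + δ', by linarith, fun s hs => ?_, fun s hs => if_pos hs.2⟩
  rcases lt_or_ge s β with hsβ | hsβ
  · refine IsGeodesicOn.congr_singleton (γ := γ) (s := s) ?_ ?_ s rfl
    · rintro s rfl
      exact hγ _ ⟨hs.1, hsβ⟩
    · filter_upwards [Iio_mem_nhds hsβ] with u hu using if_pos hu
  · have hnhds : ∀ᶠ u in 𝓝 s, u ∈ Ioo s₂ (β + δ') ∧ u ∈ Ioo α (β + δ) :=
      (show ∀ᶠ u in 𝓝 s, u ∈ Ioo s₂ (β + δ') from Ioo_mem_nhds (hs₂.2.trans_le hsβ) hs.2).and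
        (Ioo_mem_nhds hs.1 (hright s ⟨hsβ, hs.2⟩).1)
    have hss := hnhds.self_of_nhds
    refine isGeodesicOn_singleton_of_spray (q := q) (T := T) (Z := Z') (C := C) (e := e) ?_
      (hT s hss.2).1 (hpos _ (U.a_pos _ (hT s hss.2).1)) ?_ ?_ ?_ (hZ'C s hss.1) s rfl
    · filter_upwards [hnhds] with u hu
      rcases lt_or_ge u β with h | h
      · have huI : u ∈ Ioo s₂ β := ⟨hu.1.1, h⟩
        simp only [hγ', hZ', if_pos h]
        refine Prod.ext (hTeq (hs₂β u huI)).symm ?_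
        exact (φ.left_inv (htrap u ⟨huI.1.le, h⟩).1).symm
      · simp only [hγ', hZ', if_neg (not_lt.2 h), hφ]
    · exact hnhds.mono fun u hu => (hT u hu.2).2
    · exact hnhds.mono fun u hu => hZ'tar u hu.1
    · exact hnhds.mono fun u hu => hglue u hu.1

end Universe
end Friedmann

end

theorem theorem2 (n : ℕ) (M : Type*) [TopologicalSpace M] [T2Space M]
    [ChartedSpace (EuclideanSpace ℝ (Fin n)) M] [IsManifold (𝓡 n) ∞ M]
    (U : Friedmann.Universe n M)
    (hgh : U.GloballyHyperbolic) (hrh : U.RegularlyHyperbolic) (hinc : U.FutureIncomplete) :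
    ∃ t₁ ∈ U.I, Friedmann.S1 U.I U.hubble t₁ ∨ Friedmann.S2 U.I U.hubble t₁ ∨
      Friedmann.S3 U.I U.hubble t₁ := by
  by_cases hI : BddAbove U.I
  · obtain ⟨t₁, ht₁, h⟩ := U.exists_S2_or_S3_of_bddAbove hI
    exact ⟨t₁, ht₁, Or.inr h⟩
  · exact absurd hinc (Friedmann.Universe.not_futureIncomplete hgh hrh hI)
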